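/- \textbf{Theorem (QP convergence).} Let $Q\in\mathbb{R}^{n\times n}$ be symmetric positive semidefinite (possibly $Q=0$), $p\in\mathbb{R}^n$, $A\in\mathbb{R}^{m\times n}$, $b\in\mathbb{R}^m$, and consider the convex QP or LP of minimising $q(x)=\tfrac12 x^\top Qx+p^\top x$ subject to $Ax+s=b$, $s\in\mathcal C=\mathbb{R}^m_+$; it is not assumed to be feasible. With Euclidean norms, put $$r_0(x,s)=\tfrac12\bigl(|Ax+s-b|^2+\operatorname{dist}(s,\mathcal C)^2\bigr),\qquad r(x,s,t)=\tfrac12\max\{q(x)-t,0\}^2+r_0(x,s),$$ $$r^\star(t)=\inf_{x,s}r(x,s,t),\qquad M=\inf_{x,s}r_0(x,s),\qquad S=\{t\in\mathbb{R}: 0\in\partial r^\star(t)\},$$ and let $t^\star:=\min S$ when this minimum exists. Then: \begin{enumerate} \item For every $t\in\mathbb{R}$ the function $(x,s)\mapsto r(x,s,t)$ attains its minimum. \item $\partial r^\star$ satisfies the calmness criterion: $S\neq\emptyset$, and there are $\vartheta>0$, $\varphi>0$ such that for all $y\in\mathbb{R}$ and $w\in\partial r^\star(y)$ with $|w|<\vartheta$,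 the projection $\bar y=\Pi_S(y)$ exists and $|y-\bar y|\le\varphi|w|$. More precisely, there is $a>0$ such that, if $t^\star$ exists, $$r^\star(t)\ \ge\ a\,(t-t^\star)^2+M\qquad\text{for all } t\le t^\star,$$ and for every $a>0$ with this quadratic growth property the criterion holds with $\varphi=1/a$ and every $\vartheta>0$. \item For all $\sigma>0$ and $t\in\mathbb{R}$ the point $\operatorname{prox}_{\sigma r^\star}(t)=\operatorname{argmin}_u\, r^\star(u)+\tfrac1{2\sigma}(u-t)^2$ exists and is unique. Suppose that $t^\star$ exists. Let $\{t_k\}_{k\ge0}$ be generated by the proximal value method (PVM), that is, the inexact proximal point iteration on $r^\star$: for some $\sigma_k>0$, $\varepsilon_k\ge0$ with $\sum_k\varepsilon_k<\infty$ and $\varsigma\ge0$, $$|t_{k+1}-\operatorname{prox}_{\sigma_kr^\star}(t_k)|\le\varepsilon_k\min\{1,|t_{k+1}-t_k|^\varsigma\}\qquad(k\ge0).$$ If $t_0\le t^\star$ and $\{\sigma_k\}$ is nondecreasing, then $t_k$ converges to some $$\tau\in[t^\star,t^\star+\lambda],\qquad \lambda=\sum_{k=0}^\infty\varepsilon_k\min\{1,|t_{k+1}-t_k|^\varsigma\}\le\sum_{k=0}^\infty\varepsilon_k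 .$$ If moreover $\varsigma\ge1$, then the convergence is superlinear when $\sigma_k\uparrow\infty$, i.e. $|t_{k+1}-\tau|=o(|t_k-\tau|)$, and linear when $\sigma_k$ is constant, i.e. there is $\rho\in(0,1)$ with $|t_{k+1}-\tau|\le\rho|t_k-\tau|$ for all large $k$. \end{enumerate} -/

import Mathlib

open Filter Topology Set
open scoped Matrix

noncomputable section

namespace PVM

/-- `r₀(x,s) = ½ (|Ax + s - b|² + dist(s, C)²)`, the constraint part of the merit function of
`min f(x)` subject to `Ax + s = b`, `s ∈ C` (all norms are Euclidean). -/
def constraintMerit {n m : ℕ} (C : Set (EuclideanSpace ℝ (Fin m)))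
    (A : Matrix (Fin m) (Fin n) ℝ) (b : EuclideanSpace ℝ (Fin m))
    (x : EuclideanSpace ℝ (Fin n)) (s : EuclideanSpace ℝ (Fin m)) : ℝ :=
  1 / 2 * (‖WithLp.toLp 2 (A *ᵥ x.ofLp) + s - b‖ ^ 2 + Metric.infDist s C ^ 2)

/-- The merit function `r(x,s,t) = ½ max{f(x) - t, 0}² + r₀(x,s)`. -/
def merit {n m : ℕ} (f : EuclideanSpace ℝ (Fin n) → ℝ) (C : Set (EuclideanSpace ℝ (Fin m)))
    (A : Matrix (Fin m) (Fin n) ℝ) (b : EuclideanSpace ℝ (Fin m))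
    (x : EuclideanSpace ℝ (Fin n)) (s : EuclideanSpace ℝ (Fin m)) (t : ℝ) : ℝ :=
  1 / 2 * max (f x - t) 0 ^ 2 + constraintMerit C A b x s

/-- The value function `r⋆(t) = inf_{x,s} r(x,s,t)`; the infimum is over a nonempty set of
nonnegative reals. -/
def valueFun {n m : ℕ} (f : EuclideanSpace ℝ (Fin n) → ℝ) (C : Set (EuclideanSpace ℝ (Fin m)))
    (A : Matrix (Fin m) (Fin n) ℝ) (b : EuclideanSpace ℝ (Fin m)) (t : ℝ) : ℝ :=
  ⨅ z : EuclideanSpace ℝ (Fin n) × EuclideanSpace ℝ (Fin m), merit f C A b z.1 z.2 t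

/-- `M = inf_{x,s} r₀(x,s)`, the least violation of the constraints. -/
def minViolation {n m : ℕ} (C : Set (EuclideanSpace ℝ (Fin m)))
    (A : Matrix (Fin m) (Fin n) ℝ) (b : EuclideanSpace ℝ (Fin m)) : ℝ :=
  ⨅ z : EuclideanSpace ℝ (Fin n) × EuclideanSpace ℝ (Fin m), constraintMerit C A b z.1 z.2

/-- The quadratic objective `q(x) = ½ xᵀQx + pᵀx`. -/
def quadObj {n : ℕ} (Q : Matrix (Fin n) (Fin n) ℝ) (p : EuclideanSpace ℝ (Fin n))
    (x : EuclideanSpace ℝ (Fin n)) : ℝ :=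
  1 / 2 * (x.ofLp ⬝ᵥ Q *ᵥ x.ofLp) + p.ofLp ⬝ᵥ x.ofLp

/-- The nonnegative orthant `ℝ^m_+`. -/
def orthant (m : ℕ) : Set (EuclideanSpace ℝ (Fin m)) := {s | ∀ i, 0 ≤ s i}

/-- The convex subdifferential `∂h(t)` of a function on the real line. -/
def subdiff (h : ℝ → ℝ) (t : ℝ) : Set ℝ := {w | ∀ u, h t + w * (u - t) ≤ h u}

/-- The set of zeros `S = (∂h)⁻¹(0)`. -/
def zeroSet (h : ℝ → ℝ) : Set ℝ := {t | 0 ∈ subdiff h t}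

/-- `S = (∂h)⁻¹(0)` is nonempty and, for all `y` and all `w ∈ ∂h(y)` with `|w| < ϑ`, the
projection `ȳ` of `y` onto `S` exists and satisfies `|y - ȳ| ≤ φ |w|`. -/
def CalmWith (h : ℝ → ℝ) (ϑ φ : ℝ) : Prop :=
  (zeroSet h).Nonempty ∧
    ∀ y, ∀ w ∈ subdiff h y, |w| < ϑ →
      ∃ ybar ∈ zeroSet h, (∀ z ∈ zeroSet h, |y - ybar| ≤ |y - z|) ∧ |y - ybar| ≤ φ * |w|

/-- The calmness criterion for `∂h`. -/
def CalmnessCriterion (h : ℝ → ℝ) : Prop :=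
  ∃ ϑ > 0, ∃ φ > 0, CalmWith h ϑ φ

/-- `u` is a value of `prox_{σh}(t)`: a minimiser of `h + |· - t|² / (2σ)`. -/
def IsProx (h : ℝ → ℝ) (σ t u : ℝ) : Prop :=
  ∀ v, h u + 1 / (2 * σ) * (u - t) ^ 2 ≤ h v + 1 / (2 * σ) * (v - t) ^ 2

/-- The inexactness allowed in step `k`: `ε_k min{1, |t_{k+1} - t_k|^ς}`. -/
def stepError (ε : ℕ → ℝ) (ς : ℝ) (t : ℕ → ℝ) (k : ℕ) : ℝ :=
  ε k * min 1 (|t (k + 1) - t k| ^ ς)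

/-- A sequence generated by the inexact proximal point iteration for `h` with proximal
parameters `σ_k > 0` and summable errors:
`|t_{k+1} - prox_{σ_k h}(t_k)| ≤ ε_k min{1, |t_{k+1} - t_k|^ς}`. The proximal value method is this
iteration for `h = r⋆`. -/
def IsInexactProxSeq (h : ℝ → ℝ) (σ ε : ℕ → ℝ) (ς : ℝ) (t : ℕ → ℝ) : Prop :=
  (∀ k, 0 < σ k) ∧ (∀ k, 0 ≤ ε k) ∧ Summable ε ∧ 0 ≤ ς ∧
    ∀ k, ∃ u, IsProx h (σ k) (t k) u ∧ |t (k + 1) - u| ≤ stepError ε ς t k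

/-- `t_k → τ` at a (Q-)superlinear rate. -/
def SuperlinearRate (t : ℕ → ℝ) (τ : ℝ) : Prop :=
  (fun k => t (k + 1) - τ) =o[atTop] (fun k => t k - τ)

/-- `t_k → τ` at a (Q-)linear rate. -/
def LinearRate (t : ℕ → ℝ) (τ : ℝ) : Prop :=
  ∃ ρ, 0 < ρ ∧ ρ < 1 ∧ ∀ᶠ k in atTop, |t (k + 1) - τ| ≤ ρ * |t k - τ|

end PVM

end

/-! Minimising over the slack row by row turns the constraint merit into `1/4` of the squared
violation of `A x ≤ b`, so `r⋆` is the partial minimum over `x` of a jointly convex function of `(x,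
t)`, nonincreasing in `t`. The minimum is attained because the right-hand sides of solvable systems
(one convex quadratic and finitely many linear inequalities) form a closed set, on which a coercive
function is minimised.

For the growth, let `x₀` have least violation and relax each bound by its residual at `x₀`. That
residual vector is a projection of the origin, so the squared violation exceeds its minimum by at
least the squared violation of the relaxed system, which is feasible (`violation_add_relaxed_le`).
Hence `t⋆`, if it exists, is the optimal value of the program over the relaxed system. Farkas' lemma
supplies multipliers `μ` bounding `t⋆ - q(x)` by the `μ`-weighted violation
(`exists_exact_penalty`), and Cauchy-Schwarz makes this quadratic growth.

The rest happens on the line. The zero set is `ℝ` or `[t⋆, ∞)`. Growth and the subgradient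
inequality give calmness. Exact proximal steps move right, never cross `t⋆` from the left, and
shrink the distance to `t⋆` by `1 / (1 + a σ)`; summable errors perturb this. -/

namespace PVM

/-! ### Closedness of the right-hand sides of solvable quadratic and linear systems -/

section QuadraticImages

/-- A convex quadratic written as half a squared seminorm plus a linear functional. -/
noncomputable def normQuad {E F : Type*} [NormedAddCommGroup E] [InnerProductSpace ℝ E]
    [NormedAddCommGroup F] [InnerProductSpace ℝ F] (R : E →L[ℝ] F) (p : E →L[ℝ] ℝ) (x : E) : ℝ :=
  1 / 2 * ‖R x‖ ^ 2 + p x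

theorem continuous_normQuad {E F : Type*} [NormedAddCommGroup E] [InnerProductSpace ℝ E]
    [NormedAddCommGroup F] [InnerProductSpace ℝ F] (R : E →L[ℝ] F) (p : E →L[ℝ] ℝ) :
    Continuous (normQuad R p) := by
  unfold normQuad
  fun_prop

theorem normQuad_add_of_apply_eq_zero {E F : Type*} [NormedAddCommGroup E]
    [InnerProductSpace ℝ E] [NormedAddCommGroup F] [InnerProductSpace ℝ F] (R : E →L[ℝ] F)
    (p : E →L[ℝ] ℝ) (x : E) {d : E} (hd : R d = 0) :
    normQuad R p (x + d) = normQuad R p x + p d := by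
  simp only [normQuad, map_add, hd, add_zero]
  ring

variable {E F ι : Type*} [NormedAddCommGroup E] [InnerProductSpace ℝ E] [FiniteDimensional ℝ E]
  [NormedAddCommGroup F] [InnerProductSpace ℝ F] [Finite ι]

/-- The limit of a convergent sequence of right-hand sides of solvable systems of one convex
quadratic and finitely many linear inequalities is either solvable, or there is a common recession
direction along which the quadratic tends to `-∞`. -/
theorem exists_le_or_exists_recession (R : E →L[ℝ] F) (p : E →L[ℝ] ℝ) (L : ι → E →L[ℝ] ℝ)
    {x : ℕ → E} {w : ℕ → ℝ} {v : ℕ → ι → ℝ} {w₀ : ℝ} {v₀ : ι → ℝ}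
    (hw : Tendsto w atTop (𝓝 w₀)) (hv : Tendsto v atTop (𝓝 v₀))
    (hq : ∀ k, normQuad R p (x k) ≤ w k) (hL : ∀ k i, L i (x k) ≤ v k i) :
    (∃ y, normQuad R p y ≤ w₀ ∧ ∀ i, L i y ≤ v₀ i) ∨
      ∃ d, R d = 0 ∧ (∀ i, L i d ≤ 0) ∧ p d < 0 := by
  have hclosed : ∀ k, IsClosed {y | normQuad R p y ≤ w k ∧ ∀ i, L i y ≤ v k i} := by
    intro k
    simp only [ofPred_and, ofPred_forall]
    exact (isClosed_le (continuous_normQuad R p) continuous_const).inter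
      (isClosed_iInter fun i => isClosed_le (L i).continuous continuous_const)
  -- Solutions of least norm: if they escape to infinity in a direction `d` with `p d = 0`,
  -- subtracting `d` keeps them feasible yet shortens them.
  have hmin : ∀ k, ∃ y, (normQuad R p y ≤ w k ∧ ∀ i, L i y ≤ v k i) ∧
      ∀ z, (normQuad R p z ≤ w k ∧ ∀ i, L i z ≤ v k i) → ‖y‖ ≤ ‖z‖ := by
    intro k
    obtain ⟨y, hy, hyd⟩ := (hclosed k).exists_infDist_eq_dist ⟨x k, hq k, hL k⟩ 0
    refine ⟨y, hy, fun z hz => ?_⟩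
    have := Metric.infDist_le_dist_of_mem (x := (0 : E))
      (show z ∈ {y | normQuad R p y ≤ w k ∧ ∀ i, L i y ≤ v k i} from hz)
    rw [hyd] at this
    simpa using this
  choose y hy hymin using hmin
  rw [tendsto_pi_nhds] at hv
  by_cases hb : ∃ C, ∃ᶠ k in atTop, ‖y k‖ ≤ C
  · left
    obtain ⟨C, hC⟩ := hb
    obtain ⟨a, -, φ, hφ, ha⟩ := tendsto_subseq_of_frequently_bounded
      (Metric.isBounded_closedBall (x := (0 : E)) (r := C))
      (hC.mono fun k hk => by simpa using hk)
    refine ⟨a, ?_, fun i => ?_⟩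
    · exact le_of_tendsto_of_tendsto' (((continuous_normQuad R p).tendsto a).comp ha)
        (hw.comp hφ.tendsto_atTop) fun k => (hy _).1
    · exact le_of_tendsto_of_tendsto' (((L i).continuous.tendsto a).comp ha)
        ((hv i).comp hφ.tendsto_atTop) fun k => (hy _).2 i
  · push Not at hb
    have hN : Tendsto (fun k => ‖y k‖) atTop atTop :=
      tendsto_atTop.2 fun C => (hb C).mono fun k hk => hk.le
    obtain ⟨d, -, φ, hφ, hd⟩ := (isCompact_closedBall (0 : E) 1).tendsto_subseq
      (x := fun k => ‖y k‖⁻¹ • y k) (fun k => by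
        rw [mem_closedBall_zero_iff, norm_smul, norm_inv, norm_norm]
        exact inv_mul_le_one)
    set N : ℕ → ℝ := fun k => ‖y (φ k)‖ with hNdef
    set z : ℕ → E := fun k => (N k)⁻¹ • y (φ k) with hzdef
    replace hd : Tendsto z atTop (𝓝 d) := hd
    have hN' : Tendsto N atTop atTop := hN.comp hφ.tendsto_atTop
    have hNinv : Tendsto (fun k => (N k)⁻¹) atTop (𝓝 0) := tendsto_inv_atTop_zero.comp hN'
    have hNpos : ∀ᶠ k in atTop, 0 < N k := hN'.eventually_gt_atTop 0
    have hw' := hw.comp hφ.tendsto_atTop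
    have hyz : ∀ᶠ k in atTop, y (φ k) = N k • z k := by
      filter_upwards [hNpos] with k hk
      rw [hzdef, smul_inv_smul₀ hk.ne']
    have hdnorm : ‖d‖ = 1 := by
      refine tendsto_nhds_unique hd.norm (tendsto_const_nhds.congr' ?_)
      filter_upwards [hNpos] with k hk
      rw [hzdef, norm_smul, norm_inv, Real.norm_of_nonneg hk.le]
      exact (inv_mul_cancel₀ hk.ne').symm
    have hLd : ∀ i, L i d ≤ 0 := by
      intro i
      have h1 : Tendsto (fun k => (N k)⁻¹ * v (φ k) i) atTop (𝓝 0) := by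
        simpa using hNinv.mul ((hv i).comp hφ.tendsto_atTop)
      refine le_of_tendsto_of_tendsto' (((L i).continuous.tendsto d).comp hd) h1 fun k => ?_
      simp only [Function.comp, hzdef, map_smul, smul_eq_mul]
      exact mul_le_mul_of_nonneg_left ((hy _).2 i) (inv_nonneg.2 (norm_nonneg _))
    have hpz : Tendsto (fun k => p (z k)) atTop (𝓝 (p d)) := (p.continuous.tendsto d).comp hd
    -- Divide the quadratic inequality by `N ^ 2`; for `p d ≤ 0` below, drop the square and divide
    -- by `N`.
    have hRd : R d = 0 := by
      have h1 : Tendsto (fun k => 1 / 2 * ‖R (z k)‖ ^ 2 + (N k)⁻¹ * p (z k)) atTop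
          (𝓝 (1 / 2 * ‖R d‖ ^ 2 + 0 * p d)) :=
        ((((R.continuous.tendsto d).comp hd).norm.pow 2).const_mul _).add (hNinv.mul hpz)
      have h2 : Tendsto (fun k => (N k)⁻¹ ^ 2 * w (φ k)) atTop (𝓝 (0 ^ 2 * w₀)) :=
        (hNinv.pow 2).mul hw'
      have h3 := le_of_tendsto_of_tendsto' h1 h2 fun k => by
        have := mul_le_mul_of_nonneg_left (hy (φ k)).1 (sq_nonneg (N k)⁻¹)
        refine le_trans (le_of_eq ?_) this
        simp only [hzdef, map_smul, smul_eq_mul, normQuad, norm_smul, norm_inv, mul_pow,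
          Real.norm_eq_abs, sq_abs, inv_pow]
        ring
      have h4 : ‖R d‖ ^ 2 ≤ 0 := by linarith
      exact norm_eq_zero.1 (pow_eq_zero_iff two_ne_zero |>.1 (le_antisymm h4 (sq_nonneg _)))
    have hpd : p d ≤ 0 := by
      have h2 : Tendsto (fun k => (N k)⁻¹ * w (φ k)) atTop (𝓝 (0 * w₀)) := hNinv.mul hw'
      rw [zero_mul] at h2
      refine le_of_tendsto_of_tendsto' hpz h2 fun k => ?_
      simp only [hzdef, map_smul, smul_eq_mul]
      refine mul_le_mul_of_nonneg_left ?_ (inv_nonneg.2 (norm_nonneg _))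
      have := (hy (φ k)).1
      unfold normQuad at this
      linarith [sq_nonneg ‖R (y (φ k))‖]
    rcases hpd.lt_or_eq with hpd | hpd
    · exact Or.inr ⟨d, hRd, hLd, hpd⟩
    exfalso
    -- If `L i d < 0`, then `L i (y (φ k))` tends to `-∞` and leaves room for `-d`; if `L i d = 0`,
    -- nothing changes.
    have hfeas : ∀ᶠ k in atTop, ∀ i, L i (y (φ k) + -d) ≤ v (φ k) i := by
      rw [eventually_all]
      intro i
      rcases (hLd i).lt_or_eq with h | h
      · have h1 : Tendsto (fun k => N k * L i (z k)) atTop atBot :=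
          hN'.atTop_mul_neg h (((L i).continuous.tendsto d).comp hd)
        filter_upwards [hyz, h1.eventually_le_atBot (L i d + v₀ i - 1),
          ((hv i).comp hφ.tendsto_atTop).eventually (lt_mem_nhds (sub_one_lt (v₀ i)))]
          with k hk h2 h3
        have h4 : L i (y (φ k)) = N k * L i (z k) := by rw [hk, map_smul, smul_eq_mul]
        simp only [Function.comp] at h3
        rw [map_add, map_neg]
        linarith
      · refine Eventually.of_forall fun k => ?_
        rw [map_add, map_neg, h]
        simpa using (hy (φ k)).2 i
    have hinner : Tendsto (fun k => N k * inner ℝ (z k) d) atTop atTop := by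
      refine hN'.atTop_mul_pos (C := inner ℝ d d) ?_ (hd.inner tendsto_const_nhds)
      rw [real_inner_self_eq_norm_sq, hdnorm]
      norm_num
    obtain ⟨k, hk1, hk2, hk3⟩ :=
      (hyz.and (hfeas.and (hinner.eventually_gt_atTop 1))).exists
    have h1 := hymin (φ k) (y (φ k) + -d) ⟨by
      rw [normQuad_add_of_apply_eq_zero R p _ (by rw [map_neg, hRd, neg_zero]), map_neg, hpd]
      simpa using (hy (φ k)).1, hk2⟩
    have h2 : ‖y (φ k) + -d‖ ^ 2 = ‖y (φ k)‖ ^ 2 - 2 * inner ℝ (y (φ k)) d + 1 := by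
      rw [← sub_eq_add_neg, norm_sub_sq_real, hdnorm]
      norm_num
    have h3 : inner ℝ (y (φ k)) d = N k * inner ℝ (z k) d := by
      rw [hk1, real_inner_smul_left]
    have h4 := pow_le_pow_left₀ (norm_nonneg _) h1 2
    linarith

/-- The set of right-hand sides of solvable finite systems of linear inequalities is closed. -/
theorem isClosed_setOf_exists_forall_le (L : ι → E →L[ℝ] ℝ) :
    IsClosed {v : ι → ℝ | ∃ x, ∀ i, L i x ≤ v i} := by
  refine IsSeqClosed.isClosed fun v v₀ hv hv₀ => ?_
  choose x hx using hv
  rcases exists_le_or_exists_recession (0 : E →L[ℝ] ℝ) 0 L (w := fun _ => 0)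
    tendsto_const_nhds hv₀ (fun k => by simp [normQuad]) hx with ⟨y, -, hy⟩ | ⟨d, -, -, hd⟩
  · exact ⟨y, hy⟩
  · simp at hd

/-- The set of right-hand sides of solvable systems of one convex quadratic inequality and
finitely many linear inequalities is closed. -/
theorem isClosed_setOf_exists_normQuad_le (R : E →L[ℝ] F) (p : E →L[ℝ] ℝ) (L : ι → E →L[ℝ] ℝ) :
    IsClosed {z : ℝ × (ι → ℝ) | ∃ x, normQuad R p x ≤ z.1 ∧ ∀ i, L i x ≤ z.2 i} := by
  refine IsSeqClosed.isClosed fun z z₀ hz hz₀ => ?_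
  choose x hq hL using hz
  have hz₂ : Tendsto (fun k => (z k).2) atTop (𝓝 z₀.2) := (continuous_snd.tendsto z₀).comp hz₀
  rcases exists_le_or_exists_recession R p L ((continuous_fst.tendsto z₀).comp hz₀) hz₂ hq hL with
    h | ⟨d, hR, hLd, hpd⟩
  · exact h
  -- The linear part alone is solvable in the limit; going far along `d` then pushes the quadratic
  -- below its bound.
  obtain ⟨y, hy⟩ := (isClosed_setOf_exists_forall_le L).isSeqClosed (fun k => ⟨x k, hL k⟩) hz₂
  have ht : Tendsto (fun s : ℝ => normQuad R p y + s * p d) atTop atBot :=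
    tendsto_atBot_add_const_left _ _ (tendsto_id.atTop_mul_const_of_neg hpd)
  obtain ⟨s, hs, hs0⟩ := ((ht.eventually_le_atBot z₀.1).and (eventually_ge_atTop 0)).exists
  refine ⟨y + s • d, ?_, fun i => ?_⟩
  · rwa [normQuad_add_of_apply_eq_zero R p _ (by rw [map_smul, hR, smul_zero]), map_smul,
      smul_eq_mul]
  · rw [map_add, map_smul, smul_eq_mul]
    linarith [hy i, mul_nonpos_of_nonneg_of_nonpos hs0 (hLd i)]

end QuadraticImages

/-! ### Farkas' lemma and exact penalties -/

section Duality

/-- A finitely generated cone in a coordinate space is closed. -/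
theorem isClosed_setOf_exists_nonneg_combination {ι κ : Type*} [Fintype ι] [Finite κ]
    (a : ι → κ → ℝ) :
    IsClosed {y : κ → ℝ | ∃ μ : ι → ℝ, (∀ i, 0 ≤ μ i) ∧ ∀ j, ∑ i, μ i * a i j = y j} := by
  let S : κ → EuclideanSpace ℝ ι →L[ℝ] ℝ := fun j => ∑ i, a i j • EuclideanSpace.proj i
  -- Membership in the cone is solvability of `-μ ≤ 0`, `S μ ≤ y`, `-S μ ≤ -y`, whose right-hand
  -- side is continuous in `y`.
  let L : ι ⊕ (κ ⊕ κ) → EuclideanSpace ℝ ι →L[ℝ] ℝ :=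
    Sum.elim (fun i => -EuclideanSpace.proj i) (Sum.elim S fun j => -S j)
  have hS : ∀ j x, S j x = ∑ i, x i * a i j := fun j x => by
    simp [S, mul_comm]
  let g : (κ → ℝ) → ι ⊕ (κ ⊕ κ) → ℝ := fun y => Sum.elim (fun _ => 0) (Sum.elim y fun j => -y j)
  have hg : Continuous g := by
    refine continuous_pi ?_
    rintro (i | j | j)
    · exact continuous_const
    · exact continuous_apply j
    · exact (continuous_apply j).neg
  convert (isClosed_setOf_exists_forall_le L).preimage hg using 1
  ext y
  constructor
  · rintro ⟨μ, hμ, hy⟩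
    refine ⟨WithLp.toLp 2 μ, ?_⟩
    rintro (i | j | j)
    · simpa [L, g] using hμ i
    · simpa [L, g, hS] using (hy j).le
    · simpa [L, g, hS] using (hy j).ge
  · rintro ⟨x, hx⟩
    refine ⟨x, fun i => ?_, fun j => le_antisymm ?_ ?_⟩
    · simpa [L, g] using hx (Sum.inl i)
    · simpa [L, g, hS] using hx (Sum.inr (Sum.inl j))
    · simpa [L, g, hS] using hx (Sum.inr (Sum.inr j))

/-- **Farkas' lemma** for finitely many linear functionals on a finite-dimensional space. -/
theorem exists_nonneg_combination_eq_zero {E ι : Type*} [AddCommGroup E] [Module ℝ E]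
    [FiniteDimensional ℝ E] [Fintype ι] (a : ι → E →ₗ[ℝ] ℝ) (c : E →ₗ[ℝ] ℝ)
    (h : ∀ d, (∀ i, a i d ≤ 0) → 0 ≤ c d) :
    ∃ μ : ι → ℝ, (∀ i, 0 ≤ μ i) ∧ ∀ x, c x + ∑ i, μ i * a i x = 0 := by
  classical
  let e := Module.finBasis ℝ E
  let K : Set (Fin (Module.finrank ℝ E) → ℝ) :=
    {y | ∃ μ : ι → ℝ, (∀ i, 0 ≤ μ i) ∧ ∀ j, ∑ i, μ i * a i (e j) = y j}
  have hKclosed : IsClosed K := isClosed_setOf_exists_nonneg_combination fun i j => a i (e j)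
  by_cases hmem : (fun j => -c (e j)) ∈ K
  · obtain ⟨μ, hμ, hy⟩ := hmem
    refine ⟨μ, hμ, fun x => ?_⟩
    have : c + ∑ i, μ i • a i = 0 := e.ext fun j => by
      have := hy j
      simp only [LinearMap.add_apply, LinearMap.sum_apply, LinearMap.smul_apply, smul_eq_mul,
        LinearMap.zero_apply]
      linarith
    simpa using LinearMap.congr_fun this x
  · exfalso
    have hKconv : Convex ℝ K := by
      rintro y ⟨μ, hμ, hy⟩ y' ⟨μ', hμ', hy'⟩ s s' hs hs' -
      refine ⟨fun i => s * μ i + s' * μ' i, fun i => by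
        have := hμ i
        have := hμ' i
        positivity, fun j => ?_⟩
      simp only [Pi.add_apply, Pi.smul_apply, smul_eq_mul, ← hy, ← hy', add_mul,
        Finset.sum_add_distrib, Finset.mul_sum, mul_assoc]
    obtain ⟨f, u, hfc, hfK⟩ := geometric_hahn_banach_point_closed hKconv hKclosed hmem
    -- The separating functional read as a vector of `E`, with the sign that makes each `a i d ≤ 0`
    -- while `c d < 0`.
    let d : E := -∑ j, f (Pi.single j 1) • e j
    have hd : ∀ l : E →ₗ[ℝ] ℝ, l d = -f fun j => l (e j) := by
      intro l
      rw [← ContinuousLinearMap.coe_coe f, LinearMap.pi_apply_eq_sum_univ f.toLinearMap]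
      have hsingle : ∀ j, (fun k => if j = k then 1 else 0) =
          (Pi.single j 1 : Fin (Module.finrank ℝ E) → ℝ) := fun j => by
        ext k
        simp [Pi.single_apply, eq_comm]
      simp [d, mul_comm, hsingle]
    have hu : u < 0 := by
      have := hfK 0 ⟨0, by simp, by simp⟩
      simpa using this
    have hc := h d fun i => ?_
    · have h1 : f (fun j => -c (e j)) = -f fun j => c (e j) := by
        rw [← map_neg]
        rfl
      rw [hd] at hc
      linarith
    · rw [hd]
      by_contra! hneg
      set η := f fun j => a i (e j) with hη
      -- Scaled by `u / η > 0`, the generator stays in the cone and `f` takes the value `u` there,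
      -- against strict separation.
      have h1 := hfK ((u / η) • fun j => a i (e j)) ⟨fun k => if k = i then u / η else 0, fun k => by
        dsimp only
        split_ifs
        · exact (div_pos_of_neg_of_neg hu (by linarith)).le
        · exact le_rfl, fun j => by simp⟩
      rw [map_smul, smul_eq_mul, ← hη, div_mul_cancel₀ _ (by linarith)] at h1
      exact lt_irrefl _ h1

/-- Strong duality for convex quadratic programs with linear constraints, as exactness of a
weighted penalty. -/
theorem exists_exact_penalty {E F ι : Type*} [NormedAddCommGroup E] [InnerProductSpace ℝ E]
    [FiniteDimensional ℝ E] [NormedAddCommGroup F] [InnerProductSpace ℝ F] [Fintype ι]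
    (R : E →L[ℝ] F) (p : E →L[ℝ] ℝ) (L : ι → E →L[ℝ] ℝ) (β : ι → ℝ) {x₀ : E}
    (hx₀ : ∀ i, L i x₀ ≤ β i)
    (hmin : ∀ x, (∀ i, L i x ≤ β i) → normQuad R p x₀ ≤ normQuad R p x) :
    ∃ μ : ι → ℝ, (∀ i, 0 ≤ μ i) ∧
      ∀ x, normQuad R p x₀ ≤ normQuad R p x + ∑ i, μ i * max (L i x - β i) 0 := by
  classical
  let g : E →ₗ[ℝ] ℝ := (innerSL ℝ (R x₀)).toLinearMap ∘ₗ R.toLinearMap + p.toLinearMap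
  have hg : ∀ d, g d = inner ℝ (R x₀) (R d) + p d := fun d => by simp [g]
  have hexp : ∀ d, normQuad R p (x₀ + d) = normQuad R p x₀ + g d + 1 / 2 * ‖R d‖ ^ 2 := fun d => by
    simp only [normQuad, map_add, norm_add_sq_real, hg]
    ring
  -- Only active constraints matter: the others stay satisfied for small steps, so the derivative
  -- `g` at `x₀` is nonnegative on the active cone. Inactive rows later get multiplier `0`.
  obtain ⟨μ, hμ, hsum⟩ := exists_nonneg_combination_eq_zero
    (fun i : {i // L i x₀ = β i} => (L i).toLinearMap) g fun d hd => by
      have hfeas : ∀ᶠ s : ℝ in 𝓝[>] 0, ∀ i, L i (x₀ + s • d) ≤ β i := by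
        rw [eventually_all]
        intro i
        rcases (hx₀ i).lt_or_eq with hi | hi
        · have hc : Tendsto (fun s : ℝ => L i (x₀ + s • d)) (𝓝 0) (𝓝 (L i (x₀ + (0 : ℝ) • d))) :=
            Continuous.tendsto (by fun_prop) 0
          rw [zero_smul, add_zero] at hc
          exact ((hc.eventually (gt_mem_nhds hi)).filter_mono nhdsWithin_le_nhds).mono
            fun s hs => hs.le
        · filter_upwards [self_mem_nhdsWithin] with s hs
          have := mul_nonpos_of_nonneg_of_nonpos (le_of_lt hs) (hd ⟨i, hi⟩)
          simp only [map_add, map_smul, smul_eq_mul, hi]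
          simp only [ContinuousLinearMap.coe_coe] at this
          linarith
      have hlim : Tendsto (fun s : ℝ => g d + s * (1 / 2 * ‖R d‖ ^ 2)) (𝓝[>] 0)
          (𝓝 (g d + 0 * (1 / 2 * ‖R d‖ ^ 2))) :=
        (Continuous.tendsto (by fun_prop) 0).mono_left nhdsWithin_le_nhds
      rw [zero_mul, add_zero] at hlim
      refine ge_of_tendsto hlim ?_
      filter_upwards [hfeas, self_mem_nhdsWithin] with s hs hs0
      have h1 := hmin _ hs
      rw [hexp, map_smul, map_smul, norm_smul, Real.norm_of_nonneg (le_of_lt hs0), smul_eq_mul] at h1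
      refine le_of_mul_le_mul_left ?_ (show 0 < s from hs0)
      linarith
  refine ⟨fun i => if hi : L i x₀ = β i then μ ⟨i, hi⟩ else 0, fun i => ?_, fun x => ?_⟩
  · dsimp only
    split_ifs with hi
    · exact hμ _
    · exact le_rfl
  · have h1 := hexp (x - x₀)
    have h2 := hsum (x - x₀)
    rw [add_sub_cancel] at h1
    have h3 : ∑ i : {i // L i x₀ = β i}, μ i * (L i).toLinearMap (x - x₀) ≤
        ∑ i, (if hi : L i x₀ = β i then μ ⟨i, hi⟩ else 0) * max (L i x - β i) 0 := by
      have h4 : ∑ i : {i // L i x₀ = β i}, μ i * (L i).toLinearMap (x - x₀) ≤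
          ∑ i : {i // L i x₀ = β i},
            (if hi : L i x₀ = β i then μ ⟨i, hi⟩ else 0) * max (L i x - β i) 0 := by
        refine Finset.sum_le_sum fun i _ => ?_
        rw [dif_pos i.2]
        refine mul_le_mul_of_nonneg_left ?_ (hμ i)
        simp only [ContinuousLinearMap.coe_coe, map_sub, i.2]
        exact le_max_left _ _
      refine h4.trans ?_
      rw [← Fintype.sum_subtype_add_sum_subtype (fun i => L i x₀ = β i)
        fun i => (if hi : L i x₀ = β i then μ ⟨i, hi⟩ else 0) * max (L i x - β i) 0]
      refine le_add_of_nonneg_right (Finset.sum_nonneg fun i _ => ?_)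
      rw [dif_neg i.2, zero_mul]
    linarith [sq_nonneg ‖R (x - x₀)‖]

end Duality

/-! ### Nonincreasing convex functions on the line and their proximal points -/

section RealLine

variable {h : ℝ → ℝ}

theorem mem_zeroSet_iff {t : ℝ} : t ∈ zeroSet h ↔ ∀ u, h t ≤ h u := by
  simp [zeroSet, subdiff]

theorem zeroSet_eq_Ici (hanti : Antitone h) {tstar : ℝ} (hS : IsLeast (zeroSet h) tstar) :
    zeroSet h = Ici tstar :=
  Subset.antisymm (fun _ ht => hS.2 ht) fun _ ht =>
    mem_zeroSet_iff.2 fun u => (hanti ht).trans (mem_zeroSet_iff.1 hS.1 u)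

theorem continuous_of_convexOn_univ (hconv : ConvexOn ℝ univ h) : Continuous h :=
  continuousOn_univ.1 (hconv.continuousOn isOpen_univ)

theorem isClosed_zeroSet (hc : Continuous h) : IsClosed (zeroSet h) := by
  have : zeroSet h = ⋂ u, {t | h t ≤ h u} := by
    ext t
    simp [mem_zeroSet_iff]
  rw [this]
  exact isClosed_iInter fun u => isClosed_le hc continuous_const

/-- The minimisers of a continuous nonincreasing function fill the line or have a least element. -/
theorem zeroSet_eq_univ_or_exists_isLeast (hc : Continuous h) (hanti : Antitone h)
    (hne : (zeroSet h).Nonempty) : zeroSet h = univ ∨ ∃ tstar, IsLeast (zeroSet h) tstar := by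
  by_cases hb : BddBelow (zeroSet h)
  · exact Or.inr ⟨_, (isClosed_zeroSet hc).isLeast_csInf hne hb⟩
  · refine Or.inl (eq_univ_of_forall fun t => ?_)
    obtain ⟨s, hs, hst⟩ := not_bddBelow_iff.1 hb t
    exact mem_zeroSet_iff.2 fun u => (hanti hst.le).trans (mem_zeroSet_iff.1 hs u)

/-- Growth at `y` and the subgradient inequality tested at `tstar` give `a (tstar - y)² ≤ -w (tstar
- y)`; divide by `tstar - y`. -/
theorem mul_sub_le_abs_of_mem_subdiff {a tstar : ℝ}
    (hgrowth : ∀ t ≤ tstar, a * (t - tstar) ^ 2 + h tstar ≤ h t) {y w : ℝ} (hy : y ≤ tstar)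
    (hw : w ∈ subdiff h y) : a * (tstar - y) ≤ |w| := by
  rcases hy.eq_or_lt with rfl | hy
  · simp
  · have h1 := hw tstar
    have h2 := hgrowth y hy.le
    have h3 : a * (tstar - y) * (tstar - y) ≤ -w * (tstar - y) := by nlinarith
    exact (le_of_mul_le_mul_right h3 (sub_pos.2 hy)).trans (neg_le_abs w)

theorem calmWith_of_growth (hc : Continuous h) (hanti : Antitone h)
    (hne : (zeroSet h).Nonempty) {a : ℝ} (ha : 0 < a)
    (hgrowth : ∀ tstar, IsLeast (zeroSet h) tstar →
      ∀ t ≤ tstar, a * (t - tstar) ^ 2 + h tstar ≤ h t) (ϑ : ℝ) : CalmWith h ϑ (1 / a) := by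
  refine ⟨hne, fun y w hw _ => ?_⟩
  by_cases hy : y ∈ zeroSet h
  · refine ⟨y, hy, fun z _ => by simp, ?_⟩
    rw [sub_self, abs_zero]
    positivity
  rcases zeroSet_eq_univ_or_exists_isLeast hc hanti hne with hu | ⟨tstar, hS⟩
  · exact absurd (hu ▸ mem_univ y) hy
  have hlt : y < tstar := by
    rw [zeroSet_eq_Ici hanti hS] at hy
    simpa using hy
  have habs : |y - tstar| = tstar - y := by
    rw [abs_sub_comm, abs_of_pos (sub_pos.2 hlt)]
  refine ⟨tstar, hS.1, fun z hz => ?_, ?_⟩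
  · rw [habs, abs_sub_comm]
    exact (sub_le_sub_right (hS.2 hz) y).trans (le_abs_self _)
  · rw [habs, one_div, ← div_eq_inv_mul, le_div_iff₀ ha, mul_comm]
    exact mul_sub_le_abs_of_mem_subdiff (hgrowth tstar hS) hlt.le hw

theorem existsUnique_isProx (hconv : ConvexOn ℝ univ h) (hne : (zeroSet h).Nonempty) {σ : ℝ}
    (hσ : 0 < σ) (t : ℝ) : ∃! u, IsProx h σ t u := by
  obtain ⟨t₀, ht₀⟩ := hne
  rw [mem_zeroSet_iff] at ht₀
  have hc := continuous_of_convexOn_univ hconv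
  have hlim : Tendsto (fun u => h u + 1 / (2 * σ) * (u - t) ^ 2) (cocompact ℝ) atTop := by
    -- Completing the square, `(|u - t| - σ)² ≥ 0` bounds the quadratic below by `|u - t| - σ / 2`.
    refine tendsto_atTop_mono (f := fun u => ‖u‖ + (h t₀ - |t| - σ / 2)) (fun u => ?_)
      (tendsto_atTop_add_const_right _ _ tendsto_norm_cocompact_atTop)
    have h1 : |u| ≤ |u - t| + |t| := by simpa using abs_add_le (u - t) t
    have h2 : 1 / (2 * σ) * (u - t) ^ 2 - |u - t| + σ / 2 = 1 / (2 * σ) * (|u - t| - σ) ^ 2 := by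
      rw [← sq_abs (u - t)]
      field_simp
      ring
    have h3 : 0 ≤ 1 / (2 * σ) * (|u - t| - σ) ^ 2 := by positivity
    rw [Real.norm_eq_abs]
    linarith [ht₀ u]
  obtain ⟨u, hu⟩ := Continuous.exists_forall_le (by fun_prop) hlim
  refine ⟨u, hu, fun v hv => ?_⟩
  -- Two minimisers are compared with their midpoint, where the quadratic term gains a multiple of
  -- `(v - u)²`.
  have h1 := hu ((1 / 2 : ℝ) * u + (1 / 2) * v)
  have h2 := hv u
  have h3 := hconv.2 (mem_univ u) (mem_univ v) (by norm_num : (0 : ℝ) ≤ 1 / 2)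
    (by norm_num : (0 : ℝ) ≤ 1 / 2) (by norm_num)
  simp only [smul_eq_mul] at h3
  have h5 : 1 / (2 * σ) * (v - u) ^ 2 ≤ 0 := by
    have h6 : ((1 / 2 : ℝ) * u + 1 / 2 * v - t) ^ 2 =
        1 / 2 * (u - t) ^ 2 + 1 / 2 * (v - t) ^ 2 - 1 / 4 * (v - u) ^ 2 := by ring
    rw [h6] at h1
    linarith
  have h6 : (v - u) ^ 2 ≤ 0 := by
    have : 0 < 1 / (2 * σ) := by positivity
    by_contra! h7
    exact absurd h5 (not_le.2 (mul_pos this h7))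
  have h7 : v - u = 0 := pow_eq_zero_iff two_ne_zero |>.1 (le_antisymm h6 (sq_nonneg _))
  linarith

/-- Fermat's rule: compare `u` with `(1 - s) u + s v`, divide by `s` and let `s` decrease to `0`. -/
theorem IsProx.div_mem_subdiff (hconv : ConvexOn ℝ univ h) {σ t u : ℝ}
    (hu : IsProx h σ t u) : (t - u) / σ ∈ subdiff h u := by
  intro v
  have hlim : Tendsto (fun s : ℝ => h v - h u + 1 / (2 * σ) *
      (2 * (u - t) * (v - u) + s * (v - u) ^ 2)) (𝓝[>] 0)
      (𝓝 (h v - h u + 1 / (2 * σ) * (2 * (u - t) * (v - u) + 0 * (v - u) ^ 2))) :=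
    (Continuous.tendsto (by fun_prop) 0).mono_left nhdsWithin_le_nhds
  have h1 := ge_of_tendsto (b := 0) hlim (by
    filter_upwards [Ioo_mem_nhdsGT (show (0 : ℝ) < 1 by norm_num)] with s hs
    have h2 := hu ((1 - s) * u + s * v)
    have h3 := hconv.2 (mem_univ u) (mem_univ v) (sub_nonneg.2 hs.2.le) hs.1.le (by ring)
    simp only [smul_eq_mul] at h3
    refine le_of_mul_le_mul_left ?_ hs.1
    have h4 : ((1 - s) * u + s * v - t) ^ 2 =
        (u - t) ^ 2 + s * (2 * (u - t) * (v - u) + s * (v - u) ^ 2) := by ring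
    rw [h4] at h2
    linarith)
  have h2 : 1 / (2 * σ) * (2 * (u - t) * (v - u) + 0 * (v - u) ^ 2) =
      -((t - u) / σ * (v - u)) := by
    rw [one_div, mul_inv]
    ring
  linarith

theorem IsProx.le (hanti : Antitone h) {σ t u : ℝ} (hσ : 0 < σ) (hu : IsProx h σ t u) :
    t ≤ u := by
  by_contra! hlt
  have h1 := hu t
  have h2 := hanti hlt.le
  have h3 : 0 < 1 / (2 * σ) * (u - t) ^ 2 := by
    have := (sub_neg.2 hlt).ne
    positivity
  simp only [sub_self] at h1
  linarith

theorem IsProx.le_of_le {tstar : ℝ} (hS : tstar ∈ zeroSet h) {σ t u : ℝ} (hσ : 0 < σ)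
    (hu : IsProx h σ t u) (ht : t ≤ tstar) : u ≤ tstar := by
  by_contra! hlt
  have h1 := hu tstar
  have h2 := mem_zeroSet_iff.1 hS u
  have h3 : (tstar - t) ^ 2 < (u - t) ^ 2 :=
    pow_lt_pow_left₀ (by linarith) (by linarith) two_ne_zero
  have h4 := mul_lt_mul_of_pos_left h3 (show 0 < 1 / (2 * σ) by positivity)
  linarith

theorem IsProx.eq_of_mem_zeroSet {σ t u : ℝ} (hσ : 0 < σ) (hu : IsProx h σ t u)
    (ht : t ∈ zeroSet h) : u = t := by
  by_contra hne
  have h1 := hu t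
  have h2 := mem_zeroSet_iff.1 ht u
  have h3 : 0 < 1 / (2 * σ) * (u - t) ^ 2 := by
    have := sub_ne_zero.2 hne
    positivity
  simp only [sub_self] at h1
  linarith

end RealLine

/-! ### The inexact proximal point iteration -/

section Iteration

variable {h : ℝ → ℝ} {σ ε : ℕ → ℝ} {ς : ℝ} {t : ℕ → ℝ}

theorem stepError_nonneg (hε : ∀ k, 0 ≤ ε k) (k : ℕ) : 0 ≤ stepError ε ς t k :=
  mul_nonneg (hε k) (le_min zero_le_one (Real.rpow_nonneg (abs_nonneg _) _))

theorem stepError_le (hε : ∀ k, 0 ≤ ε k) (k : ℕ) : stepError ε ς t k ≤ ε k :=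
  mul_le_of_le_one_right (hε k) (min_le_left _ _)

theorem stepError_le_mul_abs (hε : ∀ k, 0 ≤ ε k) (hς : 1 ≤ ς) (k : ℕ) :
    stepError ε ς t k ≤ ε k * |t (k + 1) - t k| := by
  refine mul_le_mul_of_nonneg_left ?_ (hε k)
  rcases le_total |t (k + 1) - t k| 1 with h1 | h1
  · refine (min_le_right _ _).trans ?_
    simpa using Real.rpow_le_rpow_of_exponent_ge' (abs_nonneg _) h1 zero_le_one hς
  · exact (min_le_left _ _).trans h1

theorem summable_stepError (hε : ∀ k, 0 ≤ ε k) (hsum : Summable ε) :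
    Summable (stepError ε ς t) :=
  Summable.of_nonneg_of_le (stepError_nonneg hε) (stepError_le hε) hsum

/-- Convergence of the inexact proximal point iteration for a nonincreasing convex function on the
line, started to the left of its minimisers. -/
theorem IsInexactProxSeq.exists_tendsto (hconv : ConvexOn ℝ univ h) (hanti : Antitone h)
    {tstar : ℝ} (hS : IsLeast (zeroSet h) tstar) (ht : IsInexactProxSeq h σ ε ς t)
    (ht₀ : t 0 ≤ tstar) (hmono : Monotone σ) :
    ∃ τ, Tendsto t atTop (𝓝 τ) ∧ τ ∈ Icc tstar (tstar + ∑' k, stepError ε ς t k) := by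
  obtain ⟨hσ, hε, hsum, -, hstep⟩ := ht
  choose u hu hut using hstep
  set e := stepError ε ς t with he
  have he0 : ∀ k, 0 ≤ e k := stepError_nonneg hε
  have hesum : Summable e := summable_stepError hε hsum
  have hpart : ∀ k, ∑ j ∈ Finset.range k, e j ≤ ∑' j, e j := fun k =>
    hesum.sum_le_tsum _ fun j _ => he0 j
  -- Exact steps do not cross `tstar` from the left and fix every point right of it, so only errors
  -- carry the iterate beyond.
  have hupper : ∀ k, t k ≤ tstar + ∑ j ∈ Finset.range k, e j := by
    intro k
    induction k with
    | zero => simpa using ht₀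
    | succ k ih =>
      have h1 := (abs_le.1 (hut k)).2
      rw [Finset.sum_range_succ]
      have h0 : 0 ≤ ∑ j ∈ Finset.range k, e j := Finset.sum_nonneg fun j _ => he0 j
      rcases le_total (t k) tstar with hk | hk
      · linarith [(hu k).le_of_le hS.1 (hσ k) hk]
      · have := (hu k).eq_of_mem_zeroSet (hσ k) (by rwa [zeroSet_eq_Ici hanti hS])
        linarith
  -- Exact steps move right, so adding the accumulated errors makes the sequence monotone.
  have hsmono : Monotone fun k => t k + ∑ j ∈ Finset.range k, e j := by
    refine monotone_nat_of_le_succ fun k => ?_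
    have h1 := (abs_le.1 (hut k)).1
    have h2 := (hu k).le hanti (hσ k)
    rw [Finset.sum_range_succ]
    linarith
  have hsbdd : BddAbove (range fun k => t k + ∑ j ∈ Finset.range k, e j) := by
    refine ⟨tstar + 2 * ∑' j, e j, ?_⟩
    rintro _ ⟨k, rfl⟩
    dsimp only
    linarith [hupper k, hpart k]
  have hlim := (tendsto_atTop_ciSup hsmono hsbdd).sub hesum.hasSum.tendsto_sum_nat
  simp only [add_sub_cancel_right] at hlim
  set τ := (⨆ k, (t k + ∑ j ∈ Finset.range k, e j)) - ∑' j, e j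
  refine ⟨τ, hlim, ?_, le_of_tendsto' hlim fun k => (hupper k).trans
    (add_le_add_right (hpart k) _)⟩
  have hut' : Tendsto (fun k => t (k + 1) - u k) atTop (𝓝 0) :=
    squeeze_zero_norm hut hesum.tendsto_atTop_zero
  have hulim : Tendsto u atTop (𝓝 τ) := by
    simpa using ((tendsto_add_atTop_iff_nat 1).2 hlim).sub hut'
  -- Since `σ k ≥ σ 0`, these subgradients at `u k` vanish in the limit, and the subgradient
  -- inequality passes to `0 ∈ ∂h(τ)`.
  have hwlim : Tendsto (fun k => (t k - u k) / σ k) atTop (𝓝 0) := by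
    have h1 : Tendsto (fun k => |t k - u k| / σ 0) atTop (𝓝 0) := by
      simpa using ((hlim.sub hulim).abs).div_const (σ 0)
    refine squeeze_zero_norm (fun k => ?_) h1
    rw [Real.norm_eq_abs, abs_div, abs_of_pos (hσ k)]
    exact div_le_div_of_nonneg_left (abs_nonneg _) (hσ 0) (hmono (Nat.zero_le k))
  refine hS.2 (mem_zeroSet_iff.2 fun v => ?_)
  have hl : Tendsto (fun k => h (u k) + (t k - u k) / σ k * (v - u k)) atTop
      (𝓝 (h τ + 0 * (v - τ))) :=
    (((continuous_of_convexOn_univ hconv).tendsto τ).comp hulim).add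
      (hwlim.mul (tendsto_const_nhds.sub hulim))
  rw [zero_mul, add_zero] at hl
  exact le_of_tendsto' hl fun k => (hu k).div_mem_subdiff hconv v

/-- Under quadratic growth, the errors of the inexact proximal point iteration contract with an
explicit factor. -/
theorem IsInexactProxSeq.eventually_abs_sub_le (hconv : ConvexOn ℝ univ h) (hanti : Antitone h)
    {tstar a τ : ℝ} (hS : IsLeast (zeroSet h) tstar) (ha : 0 < a)
    (hgrowth : ∀ t ≤ tstar, a * (t - tstar) ^ 2 + h tstar ≤ h t)
    (ht : IsInexactProxSeq h σ ε ς t) (hς : 1 ≤ ς) (hτ : Tendsto t atTop (𝓝 τ))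
    (hτS : tstar ≤ τ) :
    ∀ᶠ k in atTop, |t (k + 1) - τ| ≤ (1 / (1 + a * σ k) + ε k) / (1 - ε k) * |t k - τ| := by
  obtain ⟨hσ, hε, hsum, -, hstep⟩ := ht
  choose u hu hut using hstep
  have hut' : ∀ k, |t (k + 1) - u k| ≤ ε k * |t (k + 1) - t k| := fun k =>
    (hut k).trans (stepError_le_mul_abs hε hς k)
  obtain ⟨K, hK⟩ := eventually_atTop.1
    (hsum.tendsto_atTop_zero.eventually (gt_mem_nhds zero_lt_one))
  -- At a minimiser the exact step is stationary, so `|t (k + 1) - t k| ≤ ε k * |t (k + 1) - t k|`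
  -- with `ε k < 1` stops the iteration. Otherwise the tail stays left of `tstar` and `τ = tstar`.
  by_cases hcase : ∃ k₀ ≥ K, tstar ≤ t k₀
  · obtain ⟨k₀, hk₀, hk₀S⟩ := hcase
    have hconst : ∀ k ≥ k₀, t k = t k₀ := by
      intro k hk
      induction k, hk using Nat.le_induction with
      | base => rfl
      | succ k hk ih =>
        have h1 := (hu k).eq_of_mem_zeroSet (hσ k) (by
          rw [zeroSet_eq_Ici hanti hS, ih]
          exact hk₀S)
        have h2 := hut' k
        rw [h1] at h2
        have h3 := hK k (hk₀.le.trans hk)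
        have h4 : |t (k + 1) - t k| ≤ 0 := by
          by_contra! h5
          nlinarith
        rw [← ih]
        exact sub_eq_zero.1 (abs_nonpos_iff.1 h4)
    have hτk : τ = t k₀ := tendsto_nhds_unique hτ
      (tendsto_const_nhds.congr' (eventually_atTop.2 ⟨k₀, fun k hk => (hconst k hk).symm⟩))
    filter_upwards [eventually_ge_atTop k₀] with k hk
    rw [hconst k hk, hconst (k + 1) (by omega), hτk]
    simp
  · push Not at hcase
    have hτeq : τ = tstar := le_antisymm
      (le_of_tendsto hτ (eventually_atTop.2 ⟨K, fun k hk => (hcase k hk).le⟩)) hτS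
    filter_upwards [eventually_ge_atTop K] with k hk
    rw [hτeq]
    have hlt := hcase k hk
    have hε1 := hK k hk
    have hu1 := (hu k).le_of_le hS.1 (hσ k) hlt.le
    have hu2 := (hu k).le hanti (hσ k)
    have h1 := mul_sub_le_abs_of_mem_subdiff hgrowth hu1 ((hu k).div_mem_subdiff hconv)
    rw [abs_div, abs_of_pos (hσ k), le_div_iff₀ (hσ k), abs_sub_comm,
      abs_of_nonneg (sub_nonneg.2 hu2)] at h1
    have hpos : 0 < 1 + a * σ k := by
      have := hσ k
      positivity
    have h2 : tstar - u k ≤ 1 / (1 + a * σ k) * (tstar - t k) := by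
      rw [one_div, ← div_eq_inv_mul, le_div_iff₀ hpos]
      linarith
    have habs : |t k - tstar| = tstar - t k := by
      rw [abs_sub_comm, abs_of_pos (sub_pos.2 hlt)]
    have h3 : |t (k + 1) - tstar| ≤ |t (k + 1) - u k| + (tstar - u k) := by
      have := abs_sub_le (t (k + 1)) (u k) tstar
      rwa [abs_sub_comm (u k), abs_of_nonneg (sub_nonneg.2 hu1)] at this
    have h4 : |t (k + 1) - t k| ≤ |t (k + 1) - tstar| + (tstar - t k) := by
      have := abs_sub_le (t (k + 1)) tstar (t k)
      rwa [abs_of_pos (sub_pos.2 hlt)] at this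
    have h5 := mul_le_mul_of_nonneg_left h4 (hε k)
    -- The denominator `1 - ε k` comes from absorbing the term `ε k * |t (k + 1) - tstar|` on the
    -- left.
    rw [habs, div_mul_eq_mul_div, le_div_iff₀ (sub_pos.2 hε1)]
    linarith [hut' k]

theorem superlinearRate_of_eventually_le {c : ℕ → ℝ} {τ : ℝ} (hc : Tendsto c atTop (𝓝 0))
    (h : ∀ᶠ k in atTop, |t (k + 1) - τ| ≤ c k * |t k - τ|) : SuperlinearRate t τ := by
  refine Asymptotics.isLittleO_iff.2 fun C hC => ?_
  filter_upwards [h, hc.eventually (gt_mem_nhds hC)] with k hk hCk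
  exact hk.trans (mul_le_mul_of_nonneg_right hCk.le (abs_nonneg _))

theorem linearRate_of_eventually_le {c : ℕ → ℝ} {c₀ τ : ℝ} (hc : Tendsto c atTop (𝓝 c₀))
    (hc₀ : 0 ≤ c₀) (hc₁ : c₀ < 1) (h : ∀ᶠ k in atTop, |t (k + 1) - τ| ≤ c k * |t k - τ|) :
    LinearRate t τ := by
  obtain ⟨ρ, hρ, hρ1⟩ := exists_between hc₁
  refine ⟨ρ, hc₀.trans_lt hρ, hρ1, ?_⟩
  filter_upwards [h, hc.eventually (gt_mem_nhds hρ)] with k hk hck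
  exact hk.trans (mul_le_mul_of_nonneg_right hck.le (abs_nonneg _))

theorem IsInexactProxSeq.superlinearRate (hconv : ConvexOn ℝ univ h) (hanti : Antitone h)
    {tstar a τ : ℝ} (hS : IsLeast (zeroSet h) tstar) (ha : 0 < a)
    (hgrowth : ∀ t ≤ tstar, a * (t - tstar) ^ 2 + h tstar ≤ h t)
    (ht : IsInexactProxSeq h σ ε ς t) (hς : 1 ≤ ς) (hτ : Tendsto t atTop (𝓝 τ))
    (hτS : tstar ≤ τ) (hσ : Tendsto σ atTop atTop) : SuperlinearRate t τ := by
  refine superlinearRate_of_eventually_le ?_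
    (ht.eventually_abs_sub_le hconv hanti hS ha hgrowth hς hτ hτS)
  have hε := ht.2.2.1.tendsto_atTop_zero
  have h1 : Tendsto (fun k => 1 / (1 + a * σ k)) atTop (𝓝 0) :=
    tendsto_const_nhds.div_atTop (tendsto_atTop_add_const_left _ _ (hσ.const_mul_atTop ha))
  have h2 := (h1.add hε).div (tendsto_const_nhds (x := (1 : ℝ)).sub hε) (by norm_num)
  simp only [add_zero, zero_div] at h2
  exact h2

theorem IsInexactProxSeq.linearRate (hconv : ConvexOn ℝ univ h) (hanti : Antitone h)
    {tstar a τ : ℝ} (hS : IsLeast (zeroSet h) tstar) (ha : 0 < a)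
    (hgrowth : ∀ t ≤ tstar, a * (t - tstar) ^ 2 + h tstar ≤ h t)
    (ht : IsInexactProxSeq h σ ε ς t) (hς : 1 ≤ ς) (hτ : Tendsto t atTop (𝓝 τ))
    (hτS : tstar ≤ τ) (hσ : ∀ k, σ k = σ 0) : LinearRate t τ := by
  have hpos : 0 < a * σ 0 := mul_pos ha (ht.1 0)
  have hε := ht.2.2.1.tendsto_atTop_zero
  have h1 : Tendsto (fun k => 1 / (1 + a * σ k)) atTop (𝓝 (1 / (1 + a * σ 0))) :=
    tendsto_const_nhds.congr fun k => by rw [hσ k]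
  have h2 := (h1.add hε).div (tendsto_const_nhds (x := (1 : ℝ)).sub hε) (by norm_num)
  simp only [add_zero, sub_zero, div_one] at h2
  refine linearRate_of_eventually_le h2 (by positivity) ?_
    (ht.eventually_abs_sub_le hconv hanti hS ha hgrowth hς hτ hτS)
  rw [div_lt_one (by positivity)]
  linarith

end Iteration

/-! ### Elementary inequalities for squared positive parts -/

theorem max_zero_sq_le_sq {a b : ℝ} (h : a ≤ b) : max a 0 ^ 2 ≤ b ^ 2 := by
  rcases le_total a 0 with ha | ha
  · simpa [max_eq_right ha] using sq_nonneg b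
  · rw [max_eq_left ha]
    exact pow_le_pow_left₀ ha h 2

theorem max_zero_sq_le_combination {a b c s s' : ℝ} (hs : 0 ≤ s) (hs' : 0 ≤ s')
    (hss : s + s' = 1) (h : c ≤ s * a + s' * b) :
    max c 0 ^ 2 ≤ s * max a 0 ^ 2 + s' * max b 0 ^ 2 := by
  have h1 : c ≤ s * max a 0 + s' * max b 0 :=
    h.trans (add_le_add (mul_le_mul_of_nonneg_left (le_max_left _ _) hs)
      (mul_le_mul_of_nonneg_left (le_max_left _ _) hs'))
  refine (max_zero_sq_le_sq h1).trans ?_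
  have h2 := mul_nonneg (mul_nonneg hs hs') (sq_nonneg (max a 0 - max b 0))
  obtain rfl : s' = 1 - s := by linarith
  linarith

/-- Weighted Cauchy-Schwarz for the growth constant: `w` is the objective residual, `V` the squared
violation, `s` the multiplier-weighted violation and `B = ∑ μ i ^ 2`. -/
theorem sq_add_le_of_sq_le_mul {w s B V : ℝ} (hB : 0 ≤ B) (hV : 0 ≤ V) (hs : s ^ 2 ≤ B * V) :
    (w + s) ^ 2 ≤ (2 + 4 * B) * (1 / 2 * w ^ 2 + 1 / 4 * V) := by
  have h1 : (2 * w * s) ^ 2 ≤ (2 * B * w ^ 2 + V / 2) ^ 2 := by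
    linarith [sq_nonneg (2 * B * w ^ 2 - V / 2), mul_le_mul_of_nonneg_left hs (sq_nonneg w)]
  have h2 := le_of_abs_le (abs_le_of_sq_le_sq h1 (by positivity))
  linarith

/-! ### The merit function without slack -/

section ReducedMerit

variable {E F ι : Type*} [NormedAddCommGroup E] [InnerProductSpace ℝ E]
  [NormedAddCommGroup F] [InnerProductSpace ℝ F] [Fintype ι]

/-- The squared Euclidean violation of the system `L x ≤ β`. -/
noncomputable def violation (L : ι → E →L[ℝ] ℝ) (β : ι → ℝ) (x : E) : ℝ :=
  ∑ i, max (L i x - β i) 0 ^ 2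

/-- The merit function after minimisation over the slack variable. -/
noncomputable def reducedMerit (R : E →L[ℝ] F) (p : E →L[ℝ] ℝ) (L : ι → E →L[ℝ] ℝ) (β : ι → ℝ)
    (x : E) (t : ℝ) : ℝ :=
  1 / 2 * max (normQuad R p x - t) 0 ^ 2 + 1 / 4 * violation L β x

theorem violation_nonneg (L : ι → E →L[ℝ] ℝ) (β : ι → ℝ) (x : E) : 0 ≤ violation L β x :=
  Finset.sum_nonneg fun _ _ => sq_nonneg _

theorem normQuad_combination_le (R : E →L[ℝ] F) (p : E →L[ℝ] ℝ) (x y : E) {s s' : ℝ}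
    (hs : 0 ≤ s) (hs' : 0 ≤ s') (hss : s + s' = 1) :
    normQuad R p (s • x + s' • y) ≤ s * normQuad R p x + s' * normQuad R p y := by
  have h1 : ‖s • R x + s' • R y‖ ^ 2 =
      s * ‖R x‖ ^ 2 + s' * ‖R y‖ ^ 2 - s * s' * ‖R x - R y‖ ^ 2 := by
    rw [norm_add_sq_real, norm_sub_sq_real, norm_smul, norm_smul,
      real_inner_smul_left, real_inner_smul_right, Real.norm_of_nonneg hs,
      Real.norm_of_nonneg hs']
    obtain rfl : s' = 1 - s := by linarith
    ring
  have h2 := mul_nonneg (mul_nonneg hs hs') (sq_nonneg ‖R x - R y‖)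
  simp only [normQuad, map_add, map_smul, smul_eq_mul, h1]
  linarith

theorem violation_combination_le (L : ι → E →L[ℝ] ℝ) (β : ι → ℝ) (x y : E) {s s' : ℝ}
    (hs : 0 ≤ s) (hs' : 0 ≤ s') (hss : s + s' = 1) :
    violation L β (s • x + s' • y) ≤ s * violation L β x + s' * violation L β y := by
  simp only [violation, Finset.mul_sum, ← Finset.sum_add_distrib]
  refine Finset.sum_le_sum fun i _ => max_zero_sq_le_combination hs hs' hss (le_of_eq ?_)
  simp only [map_add, map_smul, smul_eq_mul]
  obtain rfl : s' = 1 - s := by linarith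
  ring

/-- Convexity jointly in `(x, t)`, which survives minimisation over `x`. -/
theorem reducedMerit_combination_le (R : E →L[ℝ] F) (p : E →L[ℝ] ℝ) (L : ι → E →L[ℝ] ℝ)
    (β : ι → ℝ) (x y : E) (t u : ℝ) {s s' : ℝ} (hs : 0 ≤ s) (hs' : 0 ≤ s') (hss : s + s' = 1) :
    reducedMerit R p L β (s • x + s' • y) (s * t + s' * u) ≤
      s * reducedMerit R p L β x t + s' * reducedMerit R p L β y u := by
  have h1 := violation_combination_le L β x y hs hs' hss
  have h2 := max_zero_sq_le_combination (a := normQuad R p x - t) (b := normQuad R p y - u)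
    (c := normQuad R p (s • x + s' • y) - (s * t + s' * u)) hs hs' hss
    (by linarith [normQuad_combination_le R p x y hs hs' hss])
  simp only [reducedMerit]
  linarith

theorem reducedMerit_antitone (R : E →L[ℝ] F) (p : E →L[ℝ] ℝ) (L : ι → E →L[ℝ] ℝ) (β : ι → ℝ)
    (x : E) : Antitone (reducedMerit R p L β x) := by
  intro t u htu
  unfold reducedMerit
  gcongr

theorem reducedMerit_of_le (R : E →L[ℝ] F) (p : E →L[ℝ] ℝ) (L : ι → E →L[ℝ] ℝ) (β : ι → ℝ)
    {x : E} {t : ℝ} (h : normQuad R p x ≤ t) :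
    reducedMerit R p L β x t = 1 / 4 * violation L β x := by
  simp [reducedMerit, max_eq_right (sub_nonpos.2 h)]

/-- The residual vector of a least-violation point is the projection of the origin onto the set of
attainable residual vectors. -/
theorem violation_add_sum_sq_le (L : ι → E →L[ℝ] ℝ) (β : ι → ℝ) {x₀ : E}
    (hx₀ : ∀ x, violation L β x₀ ≤ violation L β x) (x : E) :
    violation L β x₀ + ∑ i, (max (L i x - β i) 0 - max (L i x₀ - β i) 0) ^ 2 ≤
      violation L β x := by
  set v : ι → ℝ := fun i => max (L i x - β i) 0 with hv
  set v₀ : ι → ℝ := fun i => max (L i x₀ - β i) 0 with hv₀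
  have hV : violation L β x = violation L β x₀ + 2 * ∑ i, v₀ i * (v i - v₀ i) +
      ∑ i, (v i - v₀ i) ^ 2 := by
    simp only [violation, Finset.mul_sum, ← Finset.sum_add_distrib]
    exact Finset.sum_congr rfl fun i _ => by ring
  have hlim : Tendsto (fun s : ℝ => 2 * ∑ i, v₀ i * (v i - v₀ i) + s * ∑ i, (v i - v₀ i) ^ 2)
      (𝓝[>] 0) (𝓝 (2 * ∑ i, v₀ i * (v i - v₀ i) + 0 * ∑ i, (v i - v₀ i) ^ 2)) :=
    (Continuous.tendsto (by fun_prop) 0).mono_left nhdsWithin_le_nhds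
  -- First variation at `x₀`: along the segment the residuals are at most the combination of the end
  -- residuals, so minimality forces `∑ i, v₀ i * (v i - v₀ i) ≥ 0`.
  have h1 := ge_of_tendsto (b := 0) hlim (by
    filter_upwards [Ioo_mem_nhdsGT (show (0 : ℝ) < 1 by norm_num)] with s hs
    have h2 : violation L β ((1 - s) • x₀ + s • x) ≤ violation L β x₀ +
        s * (2 * ∑ i, v₀ i * (v i - v₀ i) + s * ∑ i, (v i - v₀ i) ^ 2) := by
      have h3 : violation L β x₀ +
          s * (2 * ∑ i, v₀ i * (v i - v₀ i) + s * ∑ i, (v i - v₀ i) ^ 2) =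
          ∑ i, ((1 - s) * v₀ i + s * v i) ^ 2 := by
        simp only [violation, Finset.mul_sum, ← Finset.sum_add_distrib]
        exact Finset.sum_congr rfl fun i _ => by ring
      rw [h3]
      refine Finset.sum_le_sum fun i _ => max_zero_sq_le_sq ?_
      have h4 := mul_le_mul_of_nonneg_left (le_max_left (L i x₀ - β i) 0) (sub_nonneg.2 hs.2.le)
      have h5 := mul_le_mul_of_nonneg_left (le_max_left (L i x - β i) 0) hs.1.le
      simp only [map_add, map_smul, smul_eq_mul]
      linarith
    refine le_of_mul_le_mul_left ?_ hs.1
    linarith [hx₀ ((1 - s) • x₀ + s • x)])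
  rw [zero_mul, add_zero] at h1
  linarith

/-- The violation grows at least like the squared violation of the least relaxed system. -/
theorem violation_add_relaxed_le (L : ι → E →L[ℝ] ℝ) (β : ι → ℝ) {x₀ : E}
    (hx₀ : ∀ x, violation L β x₀ ≤ violation L β x) (x : E) :
    violation L β x₀ + violation L (fun i => β i + max (L i x₀ - β i) 0) x ≤
      violation L β x := by
  refine le_trans (add_le_add_right (Finset.sum_le_sum fun i _ => max_zero_sq_le_sq ?_) _)
    (violation_add_sum_sq_le L β hx₀ x)
  linarith [le_max_left (L i x - β i) 0]

theorem violation_le_of_relaxed (L : ι → E →L[ℝ] ℝ) (β : ι → ℝ) {x₀ x : E}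
    (hx : ∀ i, L i x ≤ β i + max (L i x₀ - β i) 0) : violation L β x ≤ violation L β x₀ :=
  Finset.sum_le_sum fun i _ => max_zero_sq_le_sq (by linarith [hx i])

theorem forall_le_of_violation_nonpos (L : ι → E →L[ℝ] ℝ) (β : ι → ℝ) {x : E}
    (hx : violation L β x ≤ 0) (i : ι) : L i x ≤ β i := by
  have h1 := (Finset.sum_eq_zero_iff_of_nonneg fun i _ => sq_nonneg _).1
    (le_antisymm hx (violation_nonneg L β x)) i (Finset.mem_univ i)
  have h2 := pow_eq_zero_iff two_ne_zero |>.1 h1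
  linarith [le_max_left (L i x - β i) 0]

variable [FiniteDimensional ℝ E]

/-- The reduced merit function attains its minimum. -/
theorem exists_reducedMerit_min (R : E →L[ℝ] F) (p : E →L[ℝ] ℝ) (L : ι → E →L[ℝ] ℝ) (β : ι → ℝ)
    (t : ℝ) : ∃ x, ∀ y, reducedMerit R p L β x t ≤ reducedMerit R p L β y t := by
  -- Sublevel sets in `x` may be unbounded, so the minimum is sought among residual bounds, where
  -- `Φ` is coercive and `Z` is closed.
  let Z : Set (ℝ × (ι → ℝ)) := {z | ∃ x, normQuad R p x ≤ z.1 + t ∧ ∀ i, L i x ≤ z.2 i + β i}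
  have hZ : IsClosed Z :=
    (isClosed_setOf_exists_normQuad_le R p L).preimage
      (f := fun z : ℝ × (ι → ℝ) => (z.1 + t, z.2 + β)) (by fun_prop)
  let Φ : ℝ × (ι → ℝ) → ℝ := fun z => 1 / 2 * z.1 ^ 2 + 1 / 4 * ∑ i, z.2 i ^ 2
  have hΦ : Continuous Φ := by fun_prop
  have hmem : ∀ y, (max (normQuad R p y - t) 0, fun i => max (L i y - β i) 0) ∈ Z := fun y =>
    ⟨y, by linarith [le_max_left (normQuad R p y - t) 0],
      fun i => by
        dsimp only
        linarith [le_max_left (L i y - β i) 0]⟩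
  have hlim : Tendsto Φ (cocompact _) atTop := by
    refine tendsto_atTop_mono (f := fun z => ‖z‖ + -1) (fun z => ?_)
      (tendsto_atTop_add_const_right _ _ tendsto_norm_cocompact_atTop)
    have hsum : 0 ≤ ∑ i, z.2 i ^ 2 := Finset.sum_nonneg fun _ _ => sq_nonneg _
    have h1 : ‖z‖ ≤ √(z.1 ^ 2 + ∑ i, z.2 i ^ 2) := by
      rw [Prod.norm_def]
      refine max_le (Real.abs_le_sqrt (by linarith)) ?_
      refine (pi_norm_le_iff_of_nonneg (Real.sqrt_nonneg _)).2 fun i => Real.abs_le_sqrt ?_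
      have := Finset.single_le_sum (f := fun i => z.2 i ^ 2) (fun _ _ => sq_nonneg _)
        (Finset.mem_univ i)
      linarith [sq_nonneg z.1]
    have h2 := Real.sq_sqrt (add_nonneg (sq_nonneg z.1) hsum)
    have h3 := pow_le_pow_left₀ (norm_nonneg z) h1 2
    have h4 : 1 / 4 * (z.1 ^ 2 + ∑ i, z.2 i ^ 2) ≤ Φ z := by
      simp only [Φ]
      linarith [sq_nonneg z.1]
    linarith [sq_nonneg (‖z‖ - 2)]
  obtain ⟨z, ⟨x, hxq, hxL⟩, hzmin⟩ := hΦ.continuousOn.exists_isMinOn' hZ (hmem 0)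
    (((hlim.eventually_ge_atTop _).filter_mono inf_le_left))
  refine ⟨x, fun y => le_trans ?_ (isMinOn_iff.1 hzmin _ (hmem y))⟩
  have h1 : max (normQuad R p x - t) 0 ^ 2 ≤ z.1 ^ 2 := max_zero_sq_le_sq (by linarith)
  have h2 : violation L β x ≤ ∑ i, z.2 i ^ 2 :=
    Finset.sum_le_sum fun i _ => max_zero_sq_le_sq (by linarith [hxL i])
  simp only [reducedMerit, Φ]
  linarith

theorem exists_violation_min (L : ι → E →L[ℝ] ℝ) (β : ι → ℝ) :
    ∃ x, ∀ y, violation L β x ≤ violation L β y := by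
  obtain ⟨x, hx⟩ := exists_reducedMerit_min (0 : E →L[ℝ] ℝ) 0 L β 0
  refine ⟨x, fun y => ?_⟩
  have := hx y
  simp only [reducedMerit, normQuad, zero_apply, norm_zero] at this
  linarith

end ReducedMerit

/-! ### The value function: convexity, minimisers, growth -/

section ReducedValue

variable {E F ι : Type*} [NormedAddCommGroup E] [InnerProductSpace ℝ E]
  [NormedAddCommGroup F] [InnerProductSpace ℝ F] [Fintype ι]
  {R : E →L[ℝ] F} {p : E →L[ℝ] ℝ} {L : ι → E →L[ℝ] ℝ} {β : ι → ℝ} {h : ℝ → ℝ}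

theorem antitone_of_isLeast_reducedMerit
    (hh : ∀ t, IsLeast (range fun x => reducedMerit R p L β x t) (h t)) : Antitone h := by
  intro t u htu
  obtain ⟨x, hx⟩ := (hh t).1
  rw [← hx]
  exact ((hh u).2 ⟨x, rfl⟩).trans (reducedMerit_antitone R p L β x htu)

theorem convexOn_of_isLeast_reducedMerit
    (hh : ∀ t, IsLeast (range fun x => reducedMerit R p L β x t) (h t)) :
    ConvexOn ℝ univ h := by
  refine ⟨convex_univ, fun t _ u _ s s' hs hs' hss => ?_⟩
  obtain ⟨x, hx⟩ := (hh t).1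
  obtain ⟨y, hy⟩ := (hh u).1
  rw [← hx, ← hy]
  exact ((hh _).2 ⟨s • x + s' • y, rfl⟩).trans
    (reducedMerit_combination_le R p L β x y t u hs hs' hss)

theorem violation_le_of_isLeast_reducedMerit
    (hh : ∀ t, IsLeast (range fun x => reducedMerit R p L β x t) (h t)) {x₀ : E}
    (hx₀ : ∀ x, violation L β x₀ ≤ violation L β x) (t : ℝ) :
    1 / 4 * violation L β x₀ ≤ h t := by
  obtain ⟨x, hx⟩ := (hh t).1
  rw [← hx]
  simp only [reducedMerit]
  linarith [hx₀ x, sq_nonneg (max (normQuad R p x - t) 0)]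

theorem mem_zeroSet_iff_of_isLeast_reducedMerit
    (hh : ∀ t, IsLeast (range fun x => reducedMerit R p L β x t) (h t)) {x₀ : E}
    (hx₀ : ∀ x, violation L β x₀ ≤ violation L β x) {t : ℝ} :
    t ∈ zeroSet h ↔ h t = 1 / 4 * violation L β x₀ := by
  have hlow := violation_le_of_isLeast_reducedMerit hh hx₀
  rw [mem_zeroSet_iff]
  refine ⟨fun ht => le_antisymm ?_ (hlow t), fun ht u => ht ▸ hlow u⟩
  refine (ht (normQuad R p x₀)).trans ((hh _).2 ⟨x₀, ?_⟩)
  exact reducedMerit_of_le R p L β le_rfl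

/-- At the minimum value, `violation_add_relaxed_le` forces both the objective residual and the
relaxed violation to vanish. So a least zero is the optimal value over the relaxed system. -/
theorem mem_zeroSet_iff_exists_relaxed
    (hh : ∀ t, IsLeast (range fun x => reducedMerit R p L β x t) (h t)) {x₀ : E}
    (hx₀ : ∀ x, violation L β x₀ ≤ violation L β x) {t : ℝ} :
    t ∈ zeroSet h ↔
      ∃ x, normQuad R p x ≤ t ∧ ∀ i, L i x ≤ β i + max (L i x₀ - β i) 0 := by
  rw [mem_zeroSet_iff_of_isLeast_reducedMerit hh hx₀]
  constructor
  · intro ht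
    obtain ⟨x, hx⟩ := (hh t).1
    rw [ht] at hx
    simp only [reducedMerit] at hx
    have h1 := violation_add_relaxed_le L β hx₀ x
    have h2 := violation_nonneg L (fun i => β i + max (L i x₀ - β i) 0) x
    have h3 := sq_nonneg (max (normQuad R p x - t) 0)
    refine ⟨x, ?_, forall_le_of_violation_nonpos L _ (by linarith)⟩
    have h4 : max (normQuad R p x - t) 0 ^ 2 = 0 := by linarith
    have h5 := pow_eq_zero_iff two_ne_zero |>.1 h4
    linarith [le_max_left (normQuad R p x - t) 0]
  · rintro ⟨x, hxt, hx⟩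
    refine le_antisymm (((hh t).2 ⟨x, rfl⟩).trans ?_)
      (violation_le_of_isLeast_reducedMerit hh hx₀ t)
    dsimp only
    rw [reducedMerit_of_le R p L β hxt]
    linarith [violation_le_of_relaxed L β hx]

theorem zeroSet_nonempty_of_isLeast_reducedMerit
    (hh : ∀ t, IsLeast (range fun x => reducedMerit R p L β x t) (h t)) {x₀ : E}
    (hx₀ : ∀ x, violation L β x₀ ≤ violation L β x) : (zeroSet h).Nonempty :=
  ⟨normQuad R p x₀, (mem_zeroSet_iff_exists_relaxed hh hx₀).2
    ⟨x₀, le_rfl, fun i => by linarith [le_max_left (L i x₀ - β i) 0]⟩⟩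

/-- Quadratic growth of the value function to the left of its set of minimisers. -/
theorem exists_quadratic_growth [FiniteDimensional ℝ E]
    (hh : ∀ t, IsLeast (range fun x => reducedMerit R p L β x t) (h t)) {x₀ : E}
    (hx₀ : ∀ x, violation L β x₀ ≤ violation L β x) {tstar : ℝ}
    (hS : IsLeast (zeroSet h) tstar) :
    ∃ a > 0, ∀ t ≤ tstar, a * (t - tstar) ^ 2 + 1 / 4 * violation L β x₀ ≤ h t := by
  set β' : ι → ℝ := fun i => β i + max (L i x₀ - β i) 0 with hβ'
  obtain ⟨xs, hxs, hxsL⟩ := (mem_zeroSet_iff_exists_relaxed hh hx₀).1 hS.1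
  have hopt : ∀ x, (∀ i, L i x ≤ β' i) → tstar ≤ normQuad R p x := fun x hx =>
    hS.2 ((mem_zeroSet_iff_exists_relaxed hh hx₀).2 ⟨x, le_rfl, hx⟩)
  obtain ⟨μ, hμ, hpen⟩ := exists_exact_penalty R p L β' hxsL fun x hx => hxs.trans (hopt x hx)
  have hB : 0 ≤ ∑ i, μ i ^ 2 := Finset.sum_nonneg fun _ _ => sq_nonneg _
  have hpos : 0 < 2 + 4 * ∑ i, μ i ^ 2 := by positivity
  refine ⟨1 / (2 + 4 * ∑ i, μ i ^ 2), by positivity, fun t ht => ?_⟩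
  obtain ⟨x, hx⟩ := (hh t).1
  have h1 := violation_add_relaxed_le L β hx₀ x
  -- Exact penalty at the minimiser `x` for `t`, with `normQuad R p x - t` bounded by its positive
  -- part.
  have h2 : tstar - t ≤
      max (normQuad R p x - t) 0 + ∑ i, μ i * max (L i x - β' i) 0 := by
    linarith [hpen x, hopt xs hxsL, le_max_left (normQuad R p x - t) 0]
  have h3 := (pow_le_pow_left₀ (sub_nonneg.2 ht) h2 2).trans
    (sq_add_le_of_sq_le_mul hB (violation_nonneg L β' x)
      (Finset.sum_mul_sq_le_sq_mul_sq Finset.univ μ fun i => max (L i x - β' i) 0))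
  have h4 : 1 / (2 + 4 * ∑ i, μ i ^ 2) * (t - tstar) ^ 2 ≤
      1 / 2 * max (normQuad R p x - t) 0 ^ 2 + 1 / 4 * violation L β' x := by
    rw [one_div, ← div_eq_inv_mul, div_le_iff₀ hpos]
    linarith
  rw [← hx]
  simp only [reducedMerit]
  linarith

end ReducedValue

/-! ### Translation from the quadratic program -/

section QuadraticProgram

variable {n m : ℕ}

/-- The rows of a matrix as continuous linear functionals on Euclidean space. -/
noncomputable def rowFunctional (A : Matrix (Fin m) (Fin n) ℝ) (i : Fin m) :
    EuclideanSpace ℝ (Fin n) →L[ℝ] ℝ :=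
  ∑ j, A i j • EuclideanSpace.proj j

theorem rowFunctional_apply (A : Matrix (Fin m) (Fin n) ℝ) (i : Fin m)
    (x : EuclideanSpace ℝ (Fin n)) : rowFunctional A i x = (A *ᵥ x.ofLp) i := by
  simp [rowFunctional, Matrix.mulVec, dotProduct]

open scoped MatrixOrder in
theorem exists_quadObj_eq_normQuad {Q : Matrix (Fin n) (Fin n) ℝ} (hQ : Q.PosSemidef)
    (p : EuclideanSpace ℝ (Fin n)) :
    ∃ (R : EuclideanSpace ℝ (Fin n) →L[ℝ] EuclideanSpace ℝ (Fin n))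
      (l : EuclideanSpace ℝ (Fin n) →L[ℝ] ℝ), quadObj Q p = normQuad R l := by
  -- The factor `B` in `Q = Bᵀ B` serves as `R`.
  obtain ⟨B, rfl⟩ := CStarAlgebra.nonneg_iff_eq_star_mul_self.mp hQ.nonneg
  refine ⟨Matrix.toEuclideanCLM (𝕜 := ℝ) B, innerSL ℝ p, ?_⟩
  ext x
  have h1 : ‖Matrix.toEuclideanCLM (𝕜 := ℝ) B x‖ ^ 2 = (B *ᵥ x.ofLp) ⬝ᵥ (B *ᵥ x.ofLp) := by
    rw [EuclideanSpace.real_norm_sq_eq]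
    simp [dotProduct, sq]
  have h2 : x.ofLp ⬝ᵥ (star B * B) *ᵥ x.ofLp = (B *ᵥ x.ofLp) ⬝ᵥ (B *ᵥ x.ofLp) := by
    rw [Matrix.star_eq_conjTranspose, ← Matrix.mulVec_mulVec,
      Matrix.dotProduct_mulVec, Matrix.conjTranspose_eq_transpose_of_trivial, Matrix.vecMul_transpose]
  have h3 : innerSL ℝ p x = p.ofLp ⬝ᵥ x.ofLp := by
    simp [PiLp.inner_apply, dotProduct, mul_comm]
  rw [quadObj, normQuad, h1, h2, h3]

theorem infDist_orthant_sq (s : EuclideanSpace ℝ (Fin m)) :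
    Metric.infDist s (orthant m) ^ 2 = ∑ i, max (-s i) 0 ^ 2 := by
  have hproj : WithLp.toLp 2 (fun i => max (s i) 0) ∈ orthant m := fun i => le_max_right _ _
  refine le_antisymm ?_ ?_
  · have h1 := pow_le_pow_left₀ Metric.infDist_nonneg
      (Metric.infDist_le_dist_of_mem (x := s) hproj) 2
    refine h1.trans (le_of_eq ?_)
    rw [EuclideanSpace.dist_sq_eq]
    refine Finset.sum_congr rfl fun i _ => ?_
    rw [Real.dist_eq, sq_abs]
    rcases le_total (s i) 0 with hi | hi
    · simp [max_eq_right hi, max_eq_left (neg_nonneg.2 hi)]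
    · simp [max_eq_left hi, max_eq_right (neg_nonpos.2 hi)]
  · rw [← Real.sqrt_le_left Metric.infDist_nonneg]
    refine (Metric.le_infDist ⟨_, hproj⟩).2 fun c hc => ?_
    refine Real.sqrt_le_iff.2 ⟨dist_nonneg, ?_⟩
    rw [EuclideanSpace.dist_sq_eq]
    refine Finset.sum_le_sum fun i _ => ?_
    rw [Real.dist_eq, sq_abs, ← neg_sub, neg_sq]
    exact max_zero_sq_le_sq (by linarith [hc i])

theorem constraintMerit_orthant_eq (A : Matrix (Fin m) (Fin n) ℝ) (b : EuclideanSpace ℝ (Fin m))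
    (x : EuclideanSpace ℝ (Fin n)) (s : EuclideanSpace ℝ (Fin m)) :
    constraintMerit (orthant m) A b x s =
      ∑ i, 1 / 2 * ((rowFunctional A i x - b i + s i) ^ 2 + max (-s i) 0 ^ 2) := by
  rw [constraintMerit, infDist_orthant_sq, EuclideanSpace.real_norm_sq_eq,
    ← Finset.sum_add_distrib, Finset.mul_sum]
  refine Finset.sum_congr rfl fun i _ => ?_
  simp only [rowFunctional_apply, PiLp.sub_apply, PiLp.add_apply]
  ring

/-- Each row residual is at most `c + d` with `c` the equation error and `d` the negative part of
the slack; `(c + d)² ≤ 2 (c² + d²)` yields the factor `1/4`. `bestSlack` attains equality by making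
`c = d`. -/
theorem violation_le_constraintMerit (A : Matrix (Fin m) (Fin n) ℝ)
    (b : EuclideanSpace ℝ (Fin m)) (x : EuclideanSpace ℝ (Fin n))
    (s : EuclideanSpace ℝ (Fin m)) :
    1 / 4 * violation (rowFunctional A) b.ofLp x ≤ constraintMerit (orthant m) A b x s := by
  rw [constraintMerit_orthant_eq, violation, Finset.mul_sum]
  refine Finset.sum_le_sum fun i _ => ?_
  have h1 : max (rowFunctional A i x - b i) 0 ^ 2 ≤
      ((rowFunctional A i x - b i + s i) + max (-s i) 0) ^ 2 :=
    max_zero_sq_le_sq (by linarith [le_max_left (-s i) 0])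
  linarith [sq_nonneg ((rowFunctional A i x - b i + s i) - max (-s i) 0)]

/-- The slack minimising the constraint merit at a given point. -/
noncomputable def bestSlack (A : Matrix (Fin m) (Fin n) ℝ) (b : EuclideanSpace ℝ (Fin m))
    (x : EuclideanSpace ℝ (Fin n)) : EuclideanSpace ℝ (Fin m) :=
  WithLp.toLp 2 fun i =>
    1 / 2 * max (rowFunctional A i x - b i) 0 - (rowFunctional A i x - b i)

theorem constraintMerit_bestSlack (A : Matrix (Fin m) (Fin n) ℝ) (b : EuclideanSpace ℝ (Fin m))
    (x : EuclideanSpace ℝ (Fin n)) :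
    constraintMerit (orthant m) A b x (bestSlack A b x) =
      1 / 4 * violation (rowFunctional A) b.ofLp x := by
  rw [constraintMerit_orthant_eq, violation, Finset.mul_sum]
  refine Finset.sum_congr rfl fun i _ => ?_
  simp only [bestSlack]
  rcases le_total (rowFunctional A i x - b i) 0 with hi | hi
  · rw [max_eq_right hi, max_eq_right (by linarith)]
    ring
  · rw [max_eq_left hi, max_eq_left (by linarith)]
    ring

theorem constraintMerit_nonneg (A : Matrix (Fin m) (Fin n) ℝ) (b : EuclideanSpace ℝ (Fin m))
    (z : EuclideanSpace ℝ (Fin n) × EuclideanSpace ℝ (Fin m)) :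
    0 ≤ constraintMerit (orthant m) A b z.1 z.2 := by
  unfold constraintMerit
  positivity

theorem minViolation_orthant (A : Matrix (Fin m) (Fin n) ℝ) (b : EuclideanSpace ℝ (Fin m))
    {x₀ : EuclideanSpace ℝ (Fin n)}
    (hx₀ : ∀ x, violation (rowFunctional A) b.ofLp x₀ ≤ violation (rowFunctional A) b.ofLp x) :
    minViolation (orthant m) A b = 1 / 4 * violation (rowFunctional A) b.ofLp x₀ := by
  refine le_antisymm ?_ (le_ciInf fun z => ?_)
  · rw [← constraintMerit_bestSlack]
    exact ciInf_le ⟨0, by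
      rintro _ ⟨z, rfl⟩
      exact constraintMerit_nonneg A b z⟩ (x₀, bestSlack A b x₀)
  · linarith [hx₀ z.1, violation_le_constraintMerit A b z.1 z.2]

variable {F : Type*} [NormedAddCommGroup F] [InnerProductSpace ℝ F]

theorem reducedMerit_le_merit (R : EuclideanSpace ℝ (Fin n) →L[ℝ] F)
    (l : EuclideanSpace ℝ (Fin n) →L[ℝ] ℝ) (A : Matrix (Fin m) (Fin n) ℝ)
    (b : EuclideanSpace ℝ (Fin m)) (x : EuclideanSpace ℝ (Fin n))
    (s : EuclideanSpace ℝ (Fin m)) (t : ℝ) :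
    reducedMerit R l (rowFunctional A) b.ofLp x t ≤
      merit (normQuad R l) (orthant m) A b x s t :=
  add_le_add_right (violation_le_constraintMerit A b x s) _

theorem merit_bestSlack (R : EuclideanSpace ℝ (Fin n) →L[ℝ] F)
    (l : EuclideanSpace ℝ (Fin n) →L[ℝ] ℝ) (A : Matrix (Fin m) (Fin n) ℝ)
    (b : EuclideanSpace ℝ (Fin m)) (x : EuclideanSpace ℝ (Fin n)) (t : ℝ) :
    merit (normQuad R l) (orthant m) A b x (bestSlack A b x) t =
      reducedMerit R l (rowFunctional A) b.ofLp x t := by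
  rw [merit, constraintMerit_bestSlack, reducedMerit]

theorem isLeast_valueFun (R : EuclideanSpace ℝ (Fin n) →L[ℝ] F)
    (l : EuclideanSpace ℝ (Fin n) →L[ℝ] ℝ) (A : Matrix (Fin m) (Fin n) ℝ)
    (b : EuclideanSpace ℝ (Fin m)) (t : ℝ) :
    IsLeast (range fun x => reducedMerit R l (rowFunctional A) b.ofLp x t)
      (valueFun (normQuad R l) (orthant m) A b t) := by
  obtain ⟨x, hx⟩ := exists_reducedMerit_min R l (rowFunctional A) b.ofLp t
  have hval : valueFun (normQuad R l) (orthant m) A b t =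
      reducedMerit R l (rowFunctional A) b.ofLp x t := by
    refine le_antisymm ?_
      (le_ciInf fun z => (hx z.1).trans (reducedMerit_le_merit R l A b z.1 z.2 t))
    rw [← merit_bestSlack]
    exact ciInf_le ⟨0, by
      rintro _ ⟨z, rfl⟩
      exact add_nonneg (by positivity) (constraintMerit_nonneg A b z)⟩ (x, bestSlack A b x)
  rw [hval]
  refine ⟨⟨x, rfl⟩, ?_⟩
  rintro _ ⟨y, rfl⟩
  exact hx y

end QuadraticProgram

end PVM

/-! ### The convergence theorem -/

theorem mainTheorem2 (n m : ℕ) (Q : Matrix (Fin n) (Fin n) ℝ) (hQ : Q.PosSemidef)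
    (p : EuclideanSpace ℝ (Fin n)) (A : Matrix (Fin m) (Fin n) ℝ)
    (b : EuclideanSpace ℝ (Fin m)) :
    -- (1) the merit function attains its minimum in `(x, s)` for every `t`
    (∀ t : ℝ, ∃ x s, ∀ x' s',
      PVM.merit (PVM.quadObj Q p) (PVM.orthant m) A b x s t ≤
        PVM.merit (PVM.quadObj Q p) (PVM.orthant m) A b x' s' t) ∧
    -- (2) calmness of `∂r⋆`, with constant `1 / a` for every quadratic growth constant `a` of `r⋆`
    (PVM.CalmnessCriterion (PVM.valueFun (PVM.quadObj Q p) (PVM.orthant m) A b) ∧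
      (∃ a > 0, ∀ tstar,
        IsLeast (PVM.zeroSet (PVM.valueFun (PVM.quadObj Q p) (PVM.orthant m) A b)) tstar →
        ∀ t ≤ tstar, a * (t - tstar) ^ 2 + PVM.minViolation (PVM.orthant m) A b ≤
          PVM.valueFun (PVM.quadObj Q p) (PVM.orthant m) A b t) ∧
      (∀ a > 0, (∀ tstar,
        IsLeast (PVM.zeroSet (PVM.valueFun (PVM.quadObj Q p) (PVM.orthant m) A b)) tstar →
        ∀ t ≤ tstar, a * (t - tstar) ^ 2 + PVM.minViolation (PVM.orthant m) A b ≤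
          PVM.valueFun (PVM.quadObj Q p) (PVM.orthant m) A b t) →
        ∀ ϑ > 0, PVM.CalmWith (PVM.valueFun (PVM.quadObj Q p) (PVM.orthant m) A b) ϑ (1 / a))) ∧
    -- (3) the proximal steps are well defined, and the method converges with the stated rates
    ((∀ σ > 0, ∀ t, ∃! u,
        PVM.IsProx (PVM.valueFun (PVM.quadObj Q p) (PVM.orthant m) A b) σ t u) ∧
      ∀ (tstar : ℝ),
        IsLeast (PVM.zeroSet (PVM.valueFun (PVM.quadObj Q p) (PVM.orthant m) A b)) tstar →
      ∀ (σ ε : ℕ → ℝ) (ς : ℝ) (t : ℕ → ℝ),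
        PVM.IsInexactProxSeq (PVM.valueFun (PVM.quadObj Q p) (PVM.orthant m) A b) σ ε ς t →
        t 0 ≤ tstar → Monotone σ →
        ∃ τ, Tendsto t atTop (𝓝 τ) ∧
          τ ∈ Icc tstar (tstar + ∑' k, PVM.stepError ε ς t k) ∧
          ∑' k, PVM.stepError ε ς t k ≤ ∑' k, ε k ∧
          (1 ≤ ς → Tendsto σ atTop atTop → PVM.SuperlinearRate t τ) ∧
          (1 ≤ ς → (∀ k, σ k = σ 0) → PVM.LinearRate t τ)) := by

  obtain ⟨R, l, hq⟩ := PVM.exists_quadObj_eq_normQuad hQ p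
  rw [hq]
  obtain ⟨x₀, hx₀⟩ := PVM.exists_violation_min (PVM.rowFunctional A) b.ofLp
  have hM := PVM.minViolation_orthant A b hx₀
  have hh := PVM.isLeast_valueFun R l A b
  set h := PVM.valueFun (PVM.normQuad R l) (PVM.orthant m) A b
  rw [hM]
  have hanti := PVM.antitone_of_isLeast_reducedMerit hh
  have hconv := PVM.convexOn_of_isLeast_reducedMerit hh
  have hc := PVM.continuous_of_convexOn_univ hconv
  have hne := PVM.zeroSet_nonempty_of_isLeast_reducedMerit hh hx₀
  have hmin : ∀ tstar, IsLeast (PVM.zeroSet h) tstar →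
      h tstar = 1 / 4 * PVM.violation (PVM.rowFunctional A) b.ofLp x₀ := fun tstar hS =>
    (PVM.mem_zeroSet_iff_of_isLeast_reducedMerit hh hx₀).1 hS.1
  have hgrowth : ∃ a > 0, ∀ tstar, IsLeast (PVM.zeroSet h) tstar → ∀ t ≤ tstar,
      a * (t - tstar) ^ 2 + 1 / 4 * PVM.violation (PVM.rowFunctional A) b.ofLp x₀ ≤ h t := by
    by_cases hex : ∃ tstar, IsLeast (PVM.zeroSet h) tstar
    · obtain ⟨tstar, hS⟩ := hex
      obtain ⟨a, ha, hag⟩ := PVM.exists_quadratic_growth hh hx₀ hS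
      exact ⟨a, ha, fun u hu => hu.unique hS ▸ hag⟩
    -- Without a least zero the growth condition is vacuous; `1` is a default.
    · exact ⟨1, one_pos, fun tstar hS => absurd ⟨tstar, hS⟩ hex⟩
  have hcalm : ∀ a > 0, (∀ tstar, IsLeast (PVM.zeroSet h) tstar → ∀ t ≤ tstar,
      a * (t - tstar) ^ 2 + 1 / 4 * PVM.violation (PVM.rowFunctional A) b.ofLp x₀ ≤ h t) →
      ∀ ϑ > 0, PVM.CalmWith h ϑ (1 / a) := fun a ha hag ϑ _ =>
    PVM.calmWith_of_growth hc hanti hne ha (fun tstar hS => (hmin tstar hS).symm ▸ hag tstar hS) ϑ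
  refine ⟨fun t => ?_, ⟨?_, hgrowth, hcalm⟩,
    fun σ hσ t => PVM.existsUnique_isProx hconv hne hσ t, ?_⟩
  · obtain ⟨x, hx⟩ := PVM.exists_reducedMerit_min R l (PVM.rowFunctional A) b.ofLp t
    refine ⟨x, PVM.bestSlack A b x, fun x' s' => ?_⟩
    rw [PVM.merit_bestSlack]
    exact (hx x').trans (PVM.reducedMerit_le_merit R l A b x' s' t)
  · obtain ⟨a, ha, hag⟩ := hgrowth
    exact ⟨1, one_pos, 1 / a, one_div_pos.2 ha, hcalm a ha hag 1 one_pos⟩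
  · intro tstar hS σ ε ς t ht ht₀ hmono
    obtain ⟨a, ha, hag⟩ := hgrowth
    have hag' := hag tstar hS
    rw [← hmin tstar hS] at hag'
    obtain ⟨τ, hτ, hτmem⟩ := ht.exists_tendsto hconv hanti hS ht₀ hmono
    refine ⟨τ, hτ, hτmem, ?_, fun hς hσ => ?_, fun hς hσ => ?_⟩
    · exact (PVM.summable_stepError ht.2.1 ht.2.2.1).tsum_le_tsum (PVM.stepError_le ht.2.1) ht.2.2.1
    · exact ht.superlinearRate hconv hanti hS ha hag' hς hτ hτmem.1 hσ
    · exact ht.linearRate hconv hanti hS ha hag' hς hτ hτmem.1 hσ
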